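/- **Notation.** Let $N,k\ge 0$ be integers and $V_N=\mathbb C^N$ the permutation representation of $S_N$ with basis $e_1,\dots,e_N$. For $\lambda\vdash n$ let $V_\lambda$ be the irreducible representation of $S_n$ labelled by $\lambda$. The Kronecker coefficient $C(\lambda,\lambda',\lambda'')$ of $\lambda,\lambda',\lambda''\vdash N$ is the multiplicity of $V_\lambda$ in the $S_N$-representation $V_{\lambda'}\otimes V_{\lambda''}$. The partition algebra $P_k(N)$ has the basis $d_\pi$, where $\pi$ runs over the set partitions of $\{1,\dots,k,1',\dots,k'\}$. It acts on $V_N^{\otimes k}$ by $d_\pi\mapsto D_\pi$, where $(D_\pi)^{i_{1'}\cdots i_{k'}}_{i_1\cdots i_k}$ is $1$ if indices in the same block of $\pi$ are equal and $0$ otherwise; for $N\ge 2k$ this is an isomorphism $P_k(N)\cong \mathrm{End}_{S_N}(V_N^{\otimes k})$. Put $Z_\lambda=\mathrm{Hom}_{S_N}(V_\lambda,V_N^{\otimes k})$ for $\lambda\vdash N$, on which $P_k(N)$ acts by composition, so that $V_N^{\otimes k}\cong\bigoplus_\lambda V_\lambda\otimes Z_\lambda$. Choose bases $E^\lambda_a$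 of $V_\lambda$ and $E^\lambda_\alpha$ of $Z_\lambda$ such that the vectors $E^\lambda_a\otimes E^\lambda_\alpha\in V_N^{\otimes k}$ are orthonormal with real coordinates. Let $D^\lambda$ be the matrix representation of $P_k(N)$ on $Z_\lambda$ in the basis $E^\lambda_\alpha$, and put $$Q^\lambda_{\alpha\beta}=\sum_\pi \dim(V_\lambda)\,D^\lambda_{\alpha\beta}(d_\pi^\dagger)\,d_\pi\in P_k(N),\qquad d_\pi^\dagger=\sum_{\pi'}(g^{-1})_{\pi'\pi}\,d_{\pi'}^T,\qquad g_{\pi\pi'}=\mathrm{Tr}_{V_N^{\otimes k}}(D_\pi D_{\pi'}),$$ where $T$ exchanges primed and unprimed vertices. For $\gamma\vdash k$ choose bases of $V_\gamma$ (index $p$) and of $M_{\lambda\to\gamma}=\mathrm{Hom}_{S_k}(V_\gamma,Z_\lambda)$ (index $\mu$), with $S_k$ acting on $Z_\lambda$ through permutation diagrams, such that the resulting vectors $E^{\lambda,\gamma}_{p\mu}=\sum_\alpha (B^{\lambda\to\gamma})^\alpha_{p\mu}E^\lambda_\alpha$ of $Z_\lambda$ are orthonormal for the inner product in which the $E^\lambda_\alpha$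 are orthonormal, with real coefficients $B$. Put $$Q^{\lambda,\gamma}_{\mu\nu}=\sum_{\alpha,\beta,p}(B^{\lambda\to\gamma})^\alpha_{p\mu}(B^{\lambda\to\gamma})^\beta_{p\nu}\,Q^\lambda_{\alpha\beta}.$$ Let $a^\dagger_{ij},a_{ij}$ ($1\le i,j\le N$) be the creation and annihilation operators of $N^2$ independent harmonic oscillators, $[a_{ij},a^\dagger_{kl}]=\delta_{ik}\delta_{jl}$, on the Fock space with normalized vacuum $|0\rangle$, $a_{ij}|0\rangle=0$. With $(a^\dagger)^i_j=a^\dagger_{ji}$ define $\mathcal O^{\lambda,\gamma}_{\mu\nu}=\mathrm{Tr}_{V_N^{\otimes k}}\big(Q^{\lambda,\gamma}_{\mu\nu}(a^\dagger)^{\otimes k}\big)$, and let $(\mathcal O^{\lambda,\gamma}_{\mu\nu})^\dagger$ be its adjoint. **Proposition.** Let $N\ge 2k_1+2k_2$ and $k=k_1+k_2$. Let $\lambda,\lambda',\lambda''\vdash N$, $\gamma\vdash k$, $\gamma'\vdash k_1$, $\gamma''\vdash k_2$, make any choices of bases as above for $(\lambda,\gamma)$ in degree $k$, for $(\lambda',\gamma')$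 in degree $k_1$ and for $(\lambda'',\gamma'')$ in degree $k_2$, and let $\mu,\nu$, $\mu',\nu'$, $\mu'',\nu''$ be indices of the corresponding operators (in particular $M_{\lambda\to\gamma}$, $M_{\lambda'\to\gamma'}$, $M_{\lambda''\to\gamma''}$ are non-zero). Then 1. the branching multiplicity $\dim\mathrm{Hom}_{P_{k_1}(N)\otimes P_{k_2}(N)}\big(Z_{\lambda'}\otimes Z_{\lambda''},\,Z_\lambda\big)$, where $P_{k_1}(N)\otimes P_{k_2}(N)$ acts on $Z_\lambda$ through horizontal concatenation of diagrams $P_{k_1}(N)\otimes P_{k_2}(N)\to P_{k}(N)$, is equal to $C(\lambda,\lambda',\lambda'')$; 2. if $C(\lambda,\lambda',\lambda'')=0$, then the extremal three-point correlator vanishes: $$\langle 0|\,(\mathcal O^{\lambda',\gamma'}_{\mu'\nu'})^\dagger\,(\mathcal O^{\lambda'',\gamma''}_{\mu''\nu''})^\dagger\,\mathcal O^{\lambda,\gamma}_{\mu\nu}\,|0\rangle=0 .$$ -/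

import Mathlib

open scoped TensorProduct

noncomputable section

namespace PermOsc

/-! ### Irreducible representations of symmetric groups and Kronecker coefficients -/

section Specht

/-- Row index of the `i`-th box (boxes are numbered from `0`, row after row) of the left-justified
diagram with row lengths `l`. -/
def rowOf : List ℕ → ℕ → ℕ
  | [], _ => 0
  | a :: t, i => if i < a then 0 else rowOf t (i - a) + 1

/-- Column index of the `i`-th box of the left-justified diagram with row lengths `l`. -/
def colOf : List ℕ → ℕ → ℕ
  | [], _ => 0
  | a :: t, i => if i < a then i else colOf t (i - a)

variable {n : ℕ}

/-- The parts `λ₁ ≥ λ₂ ≥ …` of an integer partition. -/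
def rowLengths (lam : n.Partition) : List ℕ := lam.parts.sort (· ≥ ·)

open Classical in
/-- The Young symmetrizer `(∑ p) (∑ sgn(q) q)` of the tableau of shape `lam` filled row by row:
`p` runs over the permutations preserving every row, `q` over those preserving every column. -/
def youngSymmetrizer (lam : n.Partition) : MonoidAlgebra ℂ (Equiv.Perm (Fin n)) :=
  (∑ p : Equiv.Perm (Fin n),
    if ∀ i, rowOf (rowLengths lam) (p i) = rowOf (rowLengths lam) i then
      MonoidAlgebra.single p 1 else 0) *
  (∑ q : Equiv.Perm (Fin n),
    if ∀ i, colOf (rowLengths lam) (q i) = colOf (rowLengths lam) i then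
      MonoidAlgebra.single q ((Equiv.Perm.sign q : ℤ) : ℂ) else 0)

/-- The irreducible representation `V_λ` of `S_n`: the left ideal `ℂ[S_n] c_λ` generated by the
Young symmetrizer. -/
abbrev Specht (lam : n.Partition) : Submodule ℂ (MonoidAlgebra ℂ (Equiv.Perm (Fin n))) :=
  LinearMap.range (LinearMap.mulRight ℂ (youngSymmetrizer lam))

theorem specht_mul_mem (lam : n.Partition) (x : MonoidAlgebra ℂ (Equiv.Perm (Fin n))) :
    ∀ y ∈ Specht lam, LinearMap.mulLeft ℂ x y ∈ Specht lam := by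
  rintro _ ⟨z, rfl⟩
  exact ⟨x * z, by simp [mul_assoc]⟩

/-- The action of `S_n` on `V_λ` by left multiplication. -/
def spechtRep (lam : n.Partition) : Representation ℂ (Equiv.Perm (Fin n)) (Specht lam) where
  toFun s := (LinearMap.mulLeft ℂ (MonoidAlgebra.single s (1 : ℂ))).restrict
    (specht_mul_mem lam _)
  map_one' := by
    ext x : 1
    apply Subtype.ext
    simp [LinearMap.restrict_apply, ← MonoidAlgebra.one_def]
  map_mul' s t := by
    ext x : 1
    apply Subtype.ext
    simp [LinearMap.restrict_apply, ← mul_assoc, MonoidAlgebra.single_mul_single]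

/-- The Kronecker coefficient `C(λ, λ', λ'')`: the multiplicity of `V_λ` in `V_λ' ⊗ V_λ''`. -/
def kronecker (lam lam' lam'' : n.Partition) : ℕ :=
  Module.finrank ℂ (Representation.IntertwiningMap (spechtRep lam)
    ((spechtRep lam').tprod (spechtRep lam'')))

end Specht

/-! ### The tensor powers `V_N^{⊗ k}` and the partition algebra `P_k(N)` -/

/-- `V_N^{⊗ k}` in coordinates: `x I` is the coefficient of `e_{I 0} ⊗ ⋯ ⊗ e_{I (k-1)}`. -/
abbrev TensorPow (N k : ℕ) : Type := (Fin k → Fin N) → ℂ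

/-- The diagonal action of `S_N`, sending `e_{i₁} ⊗ ⋯ ⊗ e_{i_k}` to
`e_{σ i₁} ⊗ ⋯ ⊗ e_{σ i_k}`. -/
def tensorRep (N k : ℕ) : Representation ℂ (Equiv.Perm (Fin N)) (TensorPow N k) where
  toFun s := LinearMap.funLeft ℂ ℂ fun I : Fin k → Fin N => fun l => s⁻¹ (I l)
  map_one' := by ext; simp [LinearMap.funLeft_apply]
  map_mul' s t := by ext; simp [LinearMap.funLeft_apply]

/-- Partition diagrams: set partitions of `{1, …, k, 1', …, k'}`, as equivalence relations.
`Sum.inl l` is the bottom vertex `l`, `Sum.inr l` is the top vertex `l'`. -/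
abbrev Diagram (k : ℕ) : Type := Setoid (Fin k ⊕ Fin k)

instance (k : ℕ) : Finite (Diagram k) :=
  Finite.of_injective (fun r : Diagram k => fun x y => r x y)
    fun _ _ h => Setoid.ext fun x y => iff_of_eq (congrFun (congrFun h x) y)

instance (k : ℕ) : Fintype (Diagram k) := Fintype.ofFinite _

instance (k : ℕ) : DecidableEq (Diagram k) := Classical.decEq _

/-- Exchange of bottom and top row. -/
abbrev Diagram.transpose {k : ℕ} (r : Diagram k) : Diagram k := Setoid.comap Sum.swap r

/-- The permutation diagram of `τ`, with blocks `{l, (τ l)'}`. -/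
abbrev Diagram.ofPerm {k : ℕ} (t : Equiv.Perm (Fin k)) : Diagram k :=
  Setoid.ker (Sum.elim t id)

open Classical in
/-- The operator `D_π` on `V_N^{⊗ k}`: the entry in row `J` (top indices) and column `I`
(bottom indices) is `1` if indices in the same block of `π` are equal, and `0` otherwise. -/
def diagMatrix (N : ℕ) {k : ℕ} (r : Diagram k) :
    Matrix (Fin k → Fin N) (Fin k → Fin N) ℂ :=
  fun J I => if ∀ x y, r x y → Sum.elim I J x = Sum.elim I J y then 1 else 0

/-- The partition algebra `P_k(N)` as the vector space with basis the partition diagrams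
(`d π` is the coefficient of `d_π`). For `N ≥ 2k` its product is the one which makes
the linear map `realize N` below an isomorphism of algebras onto `End_{S_N}(V_N^{⊗ k})`. -/
abbrev PartAlg (k : ℕ) : Type := Diagram k → ℂ

/-- The linear map `P_k(N) → End(V_N^{⊗ k})`, `d_π ↦ D_π`. -/
def realize (N : ℕ) {k : ℕ} (d : PartAlg k) : Matrix (Fin k → Fin N) (Fin k → Fin N) ℂ :=
  ∑ r, d r • diagMatrix N r

/-- The Gram matrix `g_{π π'} = Tr(D_π D_π')` on `V_N^{⊗ k}`. -/
def gram (N k : ℕ) : Matrix (Diagram k) (Diagram k) ℂ :=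
  Matrix.of fun r s => (diagMatrix N r * diagMatrix N s).trace

/-- The dual basis element `d_π^† = ∑_{π'} (g⁻¹)_{π' π} d_{π'}^T` of the diagram basis, with
respect to the bilinear form `⟨d, d'⟩ = Tr(D D'^T)`. -/
def dual (N : ℕ) {k : ℕ} (r : Diagram k) : PartAlg k :=
  ∑ s, (gram N k)⁻¹ s r • Pi.single s.transpose 1

theorem diagMatrix_perm (N : ℕ) {k : ℕ} (r : Diagram k) (s : Equiv.Perm (Fin N))
    (J I : Fin k → Fin N) :
    diagMatrix N r (fun l => s (J l)) (fun l => s (I l)) = diagMatrix N r J I := by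
  have h : ∀ x, Sum.elim (fun l => s (I l)) (fun l => s (J l)) x = s (Sum.elim I J x) := by
    rintro (x | x) <;> rfl
  simp only [diagMatrix]
  congr 1
  simp only [h, s.injective.eq_iff]

/-- `D_π` as an `S_N`-equivariant endomorphism of `V_N^{⊗ k}`. -/
def diagMap (N : ℕ) {k : ℕ} (r : Diagram k) :
    Representation.IntertwiningMap (tensorRep N k) (tensorRep N k) :=
  LinearMap.intertwiningMap_of_isIntertwiningMap _ _ (Matrix.toLin' (diagMatrix N r)) (by
    intro s v
    ext J
    simp only [tensorRep, MonoidHom.coe_mk, OneHom.coe_mk, Matrix.toLin'_apply,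
      LinearMap.funLeft_apply, Matrix.mulVec, dotProduct]
    refine Fintype.sum_equiv (Equiv.arrowCongr (Equiv.refl (Fin k)) s⁻¹) _ _ fun I => ?_
    have := diagMatrix_perm N r s⁻¹ J I
    simp only [← this]
    rfl)

/-! ### Schur–Weyl duality: the irreducible representations `Z_λ` of `P_k(N)` -/

section SchurWeyl

variable {N k : ℕ}

/-- `Z_λ = Hom_{S_N}(V_λ, V_N^{⊗ k})`, the factor paired with `V_λ` in
`V_N^{⊗ k} ≅ ⨁ V_λ ⊗ Z_λ`; the isomorphism sends `v ⊗ f` to `f v`. It is zero unless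
`N - λ₁ ≤ k`. -/
abbrev Mult (k : ℕ) (lam : N.Partition) : Type :=
  Representation.IntertwiningMap (spechtRep lam) (tensorRep N k)

/-- The action of the diagram `d_π` on `Z_λ`, by composition with `D_π`. -/
def diagAct (lam : N.Partition) (r : Diagram k) : Mult k lam →ₗ[ℂ] Mult k lam :=
  Representation.IntertwiningMap.llcomp _ _ _ (diagMap N r)

/-- The action of an element of `P_k(N)` on `Z_λ`. -/
def partAct (lam : N.Partition) (d : PartAlg k) : Mult k lam →ₗ[ℂ] Mult k lam :=
  ∑ r, d r • diagAct lam r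

/-- Bases `E^λ_a` of `V_λ` and `E^λ_α` of `Z_λ` such that the vectors `E^λ_a ⊗ E^λ_α` of
`V_N^{⊗ k}` are orthonormal and have real coordinates (Clebsch–Gordan coefficients). -/
structure ClebschGordan (k : ℕ) (lam : N.Partition) where
  /-- the vectors `E^λ_a` -/
  irr : Module.Basis (Fin (Module.finrank ℂ (Specht lam))) ℂ (Specht lam)
  /-- the vectors `E^λ_α` -/
  mult : Module.Basis (Fin (Module.finrank ℂ (Mult k lam))) ℂ (Mult k lam)
  orthonormal : ∀ a b α β, ∑ I, star (mult α (irr a) I) * mult β (irr b) I =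
    if a = b ∧ α = β then 1 else 0
  real : ∀ a α I, star (mult α (irr a) I) = mult α (irr a) I

/-- The matrix unit
`Q^λ_{αβ} = ∑_π dim(V_λ) D^λ_{αβ}(d_π^†) d_π` of `P_k(N)`, where `D^λ` is the matrix
representation of `P_k(N)` on `Z_λ` in the basis `E^λ_α`. -/
def matrixUnit {lam : N.Partition} (C : ClebschGordan k lam)
    (α β : Fin (Module.finrank ℂ (Mult k lam))) : PartAlg k :=
  fun r => (Module.finrank ℂ (Specht lam) : ℂ) *
    LinearMap.toMatrix C.mult C.mult (partAct lam (dual N r)) α β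

/-! ### Restriction of `Z_λ` to `S_k` and the matrix units of `SP_k(N)` -/

theorem diagMatrix_ofPerm (N : ℕ) {k : ℕ} (t : Equiv.Perm (Fin k)) (J I : Fin k → Fin N) :
    diagMatrix N (Diagram.ofPerm t) J I = if I = J ∘ t then 1 else 0 := by
  classical
  simp only [diagMatrix]
  congr 1
  apply propext
  constructor
  · intro h
    ext l : 1
    exact h (Sum.inl l) (Sum.inr (t l)) (by simp)
  · rintro rfl
    have e : ∀ x, Sum.elim (J ∘ t) J x = J (Sum.elim t id x) := by rintro (x | x) <;> rfl
    intro x y hxy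
    rw [e, e]
    exact congrArg J hxy

theorem diagAct_ofPerm_apply (lam : N.Partition) (t : Equiv.Perm (Fin k)) (f : Mult k lam)
    (v : Specht lam) (J : Fin k → Fin N) :
    diagAct lam (Diagram.ofPerm t) f v J = f v (J ∘ t) := by
  change Matrix.toLin' (diagMatrix N (Diagram.ofPerm t)) (f v) J = _
  simp [Matrix.toLin'_apply, Matrix.mulVec, dotProduct, diagMatrix_ofPerm]

/-- The representation of `S_k` on `Z_λ` through the permutation diagrams
`ℂ[S_k] ⊆ P_k(N)`. -/
def permRep (k : ℕ) (lam : N.Partition) :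
    Representation ℂ (Equiv.Perm (Fin k)) (Mult k lam) where
  toFun t := diagAct lam (Diagram.ofPerm t)
  map_one' := by
    apply LinearMap.ext
    intro f
    apply DFunLike.ext
    intro v
    ext J
    rw [diagAct_ofPerm_apply]
    rfl
  map_mul' s t := by
    apply LinearMap.ext
    intro f
    apply DFunLike.ext
    intro v
    ext J
    rw [Module.End.mul_apply, diagAct_ofPerm_apply, diagAct_ofPerm_apply, diagAct_ofPerm_apply]
    rfl

/-- The multiplicity space `M_{λ → γ} = Hom_{S_k}(V_γ, Z_λ)` of the restriction
`Z_λ ≅ ⨁_γ V_γ ⊗ M_{λ → γ}` to `S_k`. -/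
abbrev BranchMult (lam : N.Partition) (gam : k.Partition) : Type :=
  Representation.IntertwiningMap (spechtRep gam) (permRep k lam)

/-- A choice of bases which determines the matrix units `Q^{λ,γ}_{μν}`: bases `E^λ_a`, `E^λ_α` as
in `ClebschGordan`, and bases of `V_γ` and `M_{λ → γ}` such that the vectors `E^{λ,γ}_{pμ}` of
`Z_λ` are orthonormal with respect to the inner product on `Z_λ` for which the `E^λ_α` are
orthonormal, with real branching coefficients. -/
structure RepBasis (lam : N.Partition) (gam : k.Partition) extends ClebschGordan k lam where
  /-- the basis of `V_γ` -/
  irrS : Module.Basis (Fin (Module.finrank ℂ (Specht gam))) ℂ (Specht gam)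
  /-- the basis of `M_{λ → γ}` -/
  branch : Module.Basis (Fin (Module.finrank ℂ (BranchMult lam gam))) ℂ (BranchMult lam gam)
  branch_orthonormal : ∀ p q μ ν,
    ∑ α, star (mult.repr (branch μ (irrS p)) α) * mult.repr (branch ν (irrS q)) α =
      if p = q ∧ μ = ν then 1 else 0
  branch_real : ∀ p μ α,
    star (mult.repr (branch μ (irrS p)) α) = mult.repr (branch μ (irrS p)) α

/-- The branching coefficient `(B^{λ → γ})^α_{pμ}`:
`E^{λ,γ}_{pμ} = ∑_α (B^{λ → γ})^α_{pμ} E^λ_α`. -/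
def branchCoeff {lam : N.Partition} {gam : k.Partition} (R : RepBasis lam gam)
    (α : Fin (Module.finrank ℂ (Mult k lam))) (p : Fin (Module.finrank ℂ (Specht gam)))
    (μ : Fin (Module.finrank ℂ (BranchMult lam gam))) : ℂ :=
  R.mult.repr (R.branch μ (R.irrS p)) α

/-- The matrix unit `Q^{λ,γ}_{μν} = ∑_{α,β,p} Q^λ_{αβ} B^α_{pμ} B^β_{pν}` of `SP_k(N)`. -/
def symMatrixUnit {lam : N.Partition} {gam : k.Partition} (R : RepBasis lam gam)
    (μ ν : Fin (Module.finrank ℂ (BranchMult lam gam))) : PartAlg k :=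
  ∑ α, ∑ β, ∑ p,
    (branchCoeff R α p μ * branchCoeff R β p ν) • matrixUnit R.toClebschGordan α β

end SchurWeyl

/-! ### Branching `P_{k₁+k₂}(N) ↓ P_{k₁}(N) ⊗ P_{k₂}(N)` -/

section Branching

/-- Identification of the vertices of a diagram in `P_{k₁+k₂}` with those of a diagram in
`P_{k₁}` (on the left) and a diagram in `P_{k₂}` (on the right). -/
def splitVertex (k₁ k₂ : ℕ) :
    Fin (k₁ + k₂) ⊕ Fin (k₁ + k₂) → (Fin k₁ ⊕ Fin k₁) ⊕ (Fin k₂ ⊕ Fin k₂) :=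
  Sum.elim
    (Fin.addCases (fun l => Sum.inl (Sum.inl l)) (fun l => Sum.inr (Sum.inl l)))
    (Fin.addCases (fun l => Sum.inl (Sum.inr l)) (fun l => Sum.inr (Sum.inr l)))

/-- The horizontal concatenation `π' ⊗ π''` of two diagrams. -/
abbrev Diagram.tensor {k₁ k₂ : ℕ} (r : Diagram k₁) (s : Diagram k₂) : Diagram (k₁ + k₂) :=
  Setoid.comap (splitVertex k₁ k₂)
    { r := Sum.LiftRel r s
      iseqv :=
        { refl := by rintro (x | x) <;> simp
          symm := by
            rintro _ _ (h | h)
            · exact Sum.LiftRel.inl (r.symm h)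
            · exact Sum.LiftRel.inr (s.symm h)
          trans := by
            rintro _ _ _ (h | h) (h' | h')
            · exact Sum.LiftRel.inl (r.trans h h')
            · exact Sum.LiftRel.inr (s.trans h h') } }

/-- `Hom_{P_{k₁}(N) ⊗ P_{k₂}(N)}(Z_λ' ⊗ Z_λ'', Z_λ)`, where `Z_λ` is a representation of
`P_{k₁+k₂}(N)` and `P_{k₁}(N) ⊗ P_{k₂}(N)` is embedded by horizontal concatenation. -/
def branchHom {N : ℕ} (k₁ k₂ : ℕ) (lam lam' lam'' : N.Partition) :
    Submodule ℂ (Mult k₁ lam' ⊗[ℂ] Mult k₂ lam'' →ₗ[ℂ] Mult (k₁ + k₂) lam) where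
  carrier := {F | ∀ (r : Diagram k₁) (s : Diagram k₂),
    F ∘ₗ TensorProduct.map (diagAct lam' r) (diagAct lam'' s) = diagAct lam (r.tensor s) ∘ₗ F}
  zero_mem' := by intro r s; simp
  add_mem' := by
    intro F G hF hG r s
    rw [LinearMap.add_comp, LinearMap.comp_add, hF, hG]
  smul_mem' := by
    intro c F hF r s
    rw [LinearMap.smul_comp, LinearMap.comp_smul, hF]

/-- The branching multiplicity of `Z_λ' ⊗ Z_λ''` in the restriction of `Z_λ` to
`P_{k₁}(N) ⊗ P_{k₂}(N)`. -/
def branchingMultiplicity {N : ℕ} (k₁ k₂ : ℕ) (lam lam' lam'' : N.Partition) : ℕ :=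
  Module.finrank ℂ (branchHom k₁ k₂ lam lam' lam'')

end Branching

/-! ### The matrix harmonic oscillator -/

section Fock

/-- The states with finitely many oscillators: the polynomial `∏ X_{ij}^{k_ij}` stands for
`∏ (a†_{ij})^{k_ij} |0⟩`, and `1` for the vacuum `|0⟩`. -/
abbrev Fock (N : ℕ) : Type := MvPolynomial (Fin N × Fin N) ℂ

/-- The creation operator `a†_{ij}`. -/
def create {N : ℕ} (i j : Fin N) : Module.End ℂ (Fock N) :=
  LinearMap.mulLeft ℂ (MvPolynomial.X (i, j))

/-- The annihilation operator `a_{ij}`. -/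
def annihilate {N : ℕ} (i j : Fin N) : Module.End ℂ (Fock N) :=
  (MvPolynomial.pderiv (i, j)).toLinearMap

/-- The inner product of the Fock space: the states
`∏ (a†_{ij})^{k_ij} / √(k_ij!) |0⟩` are orthonormal. -/
def fockInner {N : ℕ} (p q : Fock N) : ℂ :=
  ∑ m ∈ p.support, star (p.coeff m) * q.coeff m * ∏ x, ((m x).factorial : ℂ)

/-- The vacuum expectation value `⟨0| A |0⟩`. -/
def vev {N : ℕ} (A : Module.End ℂ (Fock N)) : ℂ := fockInner 1 (A 1)

variable {N k : ℕ}

/-- The operator `Tr(T (a†)^{⊗ k})` attached to `T ∈ End(V_N^{⊗ k})`, where the matrix of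
creation operators has entries `(a†)^i_j = a†_{ji}`. -/
def traceCreate (T : Matrix (Fin k → Fin N) (Fin k → Fin N) ℂ) : Module.End ℂ (Fock N) :=
  ∑ J, ∑ I, T J I • (List.ofFn fun l => create (J l) (I l)).prod

/-- The operator `Tr(T† a^{⊗ k})`, where the matrix of annihilation operators has entries
`a^i_j = a_{ij}`. It is the adjoint of `Tr(T (a†)^{⊗ k})`. -/
def traceAnnihilate (T : Matrix (Fin k → Fin N) (Fin k → Fin N) ℂ) : Module.End ℂ (Fock N) :=
  ∑ J, ∑ I, T.conjTranspose J I • (List.ofFn fun l => annihilate (I l) (J l)).prod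

theorem fockInner_add_right {N : ℕ} (p q q' : Fock N) :
    fockInner p (q + q') = fockInner p q + fockInner p q' := by
  simp [fockInner, mul_add, add_mul, Finset.sum_add_distrib]

theorem fockInner_smul_right {N : ℕ} (c : ℂ) (p q : Fock N) :
    fockInner p (c • q) = c * fockInner p q := by
  simp only [fockInner, Finset.mul_sum, MvPolynomial.coeff_smul, smul_eq_mul]
  exact Finset.sum_congr rfl fun m _ => by ring

theorem fockInner_star {N : ℕ} (p q : Fock N) : star (fockInner p q) = fockInner q p := by
  have e : ∀ p q : Fock N, fockInner p q = ∑ m ∈ p.support ∪ q.support,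
      star (p.coeff m) * q.coeff m * ∏ x, ((m x).factorial : ℂ) := fun p q =>
    Finset.sum_subset Finset.subset_union_left fun m _ hm => by
      simp [MvPolynomial.notMem_support_iff.mp hm]
  rw [e, e q p, Finset.union_comm, star_sum]
  refine Finset.sum_congr rfl fun m _ => ?_
  simp [mul_comm]

theorem fockInner_create {N : ℕ} (i j : Fin N) (p q : Fock N) :
    fockInner (create i j p) q = fockInner p (annihilate i j q) := by
  have hd : ∀ m, (annihilate i j q).coeff m =
      (m (i, j) + 1) * q.coeff (Finsupp.single (i, j) 1 + m) := by
    intro m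
    have := MvPolynomial.coeff_pderiv (i := (i, j)) q m
    rw [add_comm m, mul_comm] at this
    exact this
  have hcr : create i j p = MvPolynomial.X (i, j) * p := rfl
  rw [fockInner, fockInner, hcr, MvPolynomial.support_X_mul, Finset.sum_map]
  refine Finset.sum_congr rfl fun m _ => ?_
  rw [addLeftEmbedding_apply, MvPolynomial.coeff_X_mul, hd]
  have hf : ∏ x, (((Finsupp.single (i, j) 1 + m : Fin N × Fin N →₀ ℕ) x).factorial : ℂ) =
      (m (i, j) + 1) * ∏ x, ((m x).factorial : ℂ) := by
    rw [← Finset.mul_prod_erase _ _ (Finset.mem_univ (i, j)),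
      ← Finset.mul_prod_erase _ (fun x => ((m x).factorial : ℂ)) (Finset.mem_univ (i, j)),
      ← mul_assoc]
    congr 1
    · rw [Finsupp.add_apply, Finsupp.single_eq_same, add_comm, Nat.factorial_succ]
      push_cast
      ring
    · refine Finset.prod_congr rfl fun x hx => ?_
      simp [Finsupp.single_eq_of_ne (Finset.ne_of_mem_erase hx)]
  rw [hf]
  ring

/-- `Tr(T† a^{⊗ k})` is the adjoint of `Tr(T (a†)^{⊗ k})`. -/
theorem fockInner_traceCreate (T : Matrix (Fin k → Fin N) (Fin k → Fin N) ℂ) (p q : Fock N) :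
    fockInner (traceCreate T p) q = fockInner p (traceAnnihilate T q) := by
  have hl : ∀ (n : ℕ) (u v : Fin n → Fin N) (p q : Fock N),
      fockInner ((List.ofFn fun l => create (u l) (v l)).prod p) q =
        fockInner p ((List.ofFn fun l => annihilate (u l) (v l)).prod q) := by
    have hc : ∀ (a b c d : Fin N), Commute (annihilate a b) (annihilate c d) := by
      intro a b c d
      refine LinearMap.ext fun q => ?_
      have h : ⁅(MvPolynomial.pderiv (a, b) : Derivation ℂ (Fock N) (Fock N)),
          (MvPolynomial.pderiv (c, d) : Derivation ℂ (Fock N) (Fock N))⁆ = 0 := by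
        refine MvPolynomial.derivation_ext fun x => ?_
        rw [Derivation.commutator_apply, MvPolynomial.pderiv_X, MvPolynomial.pderiv_X]
        simp only [Pi.single_apply]
        split_ifs <;> simp
      have h2 := DFunLike.congr_fun h q
      rw [Derivation.commutator_apply] at h2
      exact sub_eq_zero.mp h2
    intro n
    induction n with
    | zero => intro u v p q; simp
    | succ n ih =>
      intro u v p q
      rw [List.ofFn_succ, List.ofFn_succ, List.prod_cons, List.prod_cons, Module.End.mul_apply,
        fockInner_create, ih]
      have : Commute (annihilate (u 0) (v 0))
          (List.ofFn fun l : Fin n => annihilate (u l.succ) (v l.succ)).prod :=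
        Commute.list_prod_right _ _ fun x hx => by
          obtain ⟨l, rfl⟩ := List.mem_ofFn.mp hx
          exact hc _ _ _ _
      rw [this.eq, Module.End.mul_apply]
  have hs : ∀ {ι : Type} (s : Finset ι) (p : Fock N) (f : ι → Fock N),
      fockInner p (∑ x ∈ s, f x) = ∑ x ∈ s, fockInner p (f x) := by
    classical
    intro ι s p f
    induction s using Finset.induction_on with
    | empty => simp [fockInner]
    | insert a s ha ih => rw [Finset.sum_insert ha, Finset.sum_insert ha, fockInner_add_right, ih]
  have hs' : ∀ {ι : Type} (s : Finset ι) (f : ι → Fock N) (q : Fock N),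
      fockInner (∑ x ∈ s, f x) q = ∑ x ∈ s, fockInner (f x) q := by
    intro ι s f q
    rw [← fockInner_star, hs, star_sum]
    exact Finset.sum_congr rfl fun x _ => fockInner_star _ _
  simp only [traceCreate, traceAnnihilate, LinearMap.sum_apply, LinearMap.smul_apply, hs, hs',
    fockInner_smul_right]
  rw [Finset.sum_comm]
  refine Finset.sum_congr rfl fun I _ => Finset.sum_congr rfl fun J _ => ?_
  rw [← hl, ← fockInner_star, fockInner_smul_right, star_mul', fockInner_star,
    Matrix.conjTranspose_apply]

/-- The operator `O^{λ,γ}_{μν} = Tr(Q^{λ,γ}_{μν} (a†)^{⊗ k})`. -/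
def repOperator {lam : N.Partition} {gam : k.Partition} (R : RepBasis lam gam)
    (μ ν : Fin (Module.finrank ℂ (BranchMult lam gam))) : Module.End ℂ (Fock N) :=
  traceCreate (realize N (symMatrixUnit R μ ν))

/-- The adjoint `(O^{λ,γ}_{μν})†`. -/
def repOperatorAdj {lam : N.Partition} {gam : k.Partition} (R : RepBasis lam gam)
    (μ ν : Fin (Module.finrank ℂ (BranchMult lam gam))) : Module.End ℂ (Fock N) :=
  traceAnnihilate (realize N (symMatrixUnit R μ ν))

end Fock

end PermOsc

end

open scoped TensorProduct

noncomputable section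

namespace PermOsc

/-! ### The span and the linear independence of the operators `D_π` -/

/-! Both parts rest on two facts: the diagrams span `End_{S_N}(V_N^{⊗ k})`
(`exists_realize_mulVec`), and each basis vector `E_α` of `Z_λ` is an orthonormal copy of `V_λ` in
`V_N^{⊗ k}` whose orthogonal projection is an equivariant retraction (`coproj`).

Multiplicity: an intertwiner `φ : V_λ → V_λ' ⊗ V_λ''` gives the map `f' ⊗ f'' ↦ (f' ⊗ f'') ∘ φ` in
`branchHom`. Fix copies `f'`, `f''` with retractions `g'`, `g''`. Then `φ` is recovered by applying
`g' ⊗ g''` to the value at `f' ⊗ f''`. Conversely, any `x` in `Z_λ'` equals `(x g') f'`, where `x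
g'` is an equivariant endomorphism, so an element of `branchHom` is determined by its value at `f' ⊗
f''`. Neither Schur's lemma nor semisimplicity is needed (`branchOfIntertwiner_bijective`).

Correlator: for `N ≥ 2k` the diagrams are also independent and the Gram matrix is invertible, so the
dual-basis formula for `Q^λ_{αβ}` realizes `∑_a |E_a ⊗ E_α⟩⟨E_a ⊗ E_β|` (`realize_matrixUnit`).
Wick's theorem turns the correlator into a sum over permutations of the `k₁ + k₂` tensor slots
(`fockInner_traceCreate_one`). In each term the sum over row indices pairs a product of vectors from
copies of `V_λ'` and `V_λ''` with a vector from a copy of `V_λ`. That pairing is a matrix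
coefficient of an intertwiner `V_λ → V_λ' ⊗ V_λ''`, so it vanishes with the Kronecker coefficient
(`sum_mul_mul_eq_zero`). -/

/-- Two labellings with the same level sets differ by a permutation of the labels. -/
theorem exists_perm_comp_eq {α β : Type*} [Finite β] {K K' : α → β}
    (h : Setoid.ker K = Setoid.ker K') : ∃ s : Equiv.Perm β, ∀ x, s (K x) = K' x := by
  classical
  have := Fintype.ofFinite β
  -- Both images are identified with the quotient by the common kernel; a bijection between subsets
  -- of a finite set extends to a permutation.
  let e : {x // x ∈ Set.range K} ≃ {x // x ∈ Set.range K'} :=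
    (Setoid.quotientKerEquivRange K).symm.trans
      ((Quotient.congr (Equiv.refl α) fun x y => by
        change Setoid.ker K x y ↔ Setoid.ker K' x y
        rw [h]).trans (Setoid.quotientKerEquivRange K'))
  refine ⟨e.extendSubtype, fun x => ?_⟩
  rw [e.extendSubtype_apply_of_mem _ ⟨x, rfl⟩]
  have h1 : (Setoid.quotientKerEquivRange K).symm ⟨K x, ⟨x, rfl⟩⟩ = Quotient.mk _ x := by
    rw [Equiv.symm_apply_eq]
    rfl
  simp only [e, Equiv.trans_apply, h1]
  rfl

variable {N k : ℕ}

open Classical in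
theorem diagMatrix_eq (r : Diagram k) (J I : Fin k → Fin N) :
    diagMatrix N r J I = if r ≤ Setoid.ker (Sum.elim I J) then 1 else 0 := by
  simp only [diagMatrix]
  congr 1

open Classical in
/-- The indicator matrix of the labellings whose level sets are the blocks of `r`. -/
def blockMatrix (N : ℕ) {k : ℕ} (r : Diagram k) :
    Matrix (Fin k → Fin N) (Fin k → Fin N) ℂ :=
  fun J I => if r = Setoid.ker (Sum.elim I J) then 1 else 0

-- Every labelling has exactly one level-set partition, and `D_r` sees it precisely when that
-- partition is coarser than or equal to `r`. The relation is unitriangular for refinement.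
open Classical in
theorem diagMatrix_eq_sum (r : Diagram k) :
    diagMatrix N r = ∑ s : Diagram k, if r ≤ s then blockMatrix N s else 0 := by
  ext J I
  rw [Matrix.sum_apply, diagMatrix_eq, Finset.sum_eq_single (Setoid.ker (Sum.elim I J))]
  · split_ifs <;> simp [blockMatrix]
  · intro s _ hs
    split_ifs <;> simp [blockMatrix, hs]
  · simp

/-- Möbius inversion on the partition lattice, by induction from the coarsest partition downwards.
-/
theorem blockMatrix_mem_span (r : Diagram k) :
    blockMatrix N r ∈ Submodule.span ℂ (Set.range (diagMatrix N (k := k))) := by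
  classical
  induction r using WellFoundedGT.induction with
  | ind r ih =>
    have h : blockMatrix N r = diagMatrix N r -
        ∑ s ∈ Finset.univ.erase r, if r ≤ s then blockMatrix N s else 0 := by
      rw [diagMatrix_eq_sum, ← Finset.add_sum_erase _ _ (Finset.mem_univ r)]
      simp
    rw [h]
    refine Submodule.sub_mem _ (Submodule.subset_span ⟨r, rfl⟩) (Submodule.sum_mem _ fun s hs => ?_)
    split_ifs with hrs
    · exact ih s (lt_of_le_of_ne hrs (Finset.ne_of_mem_erase hs).symm)
    · exact Submodule.zero_mem _

/-- A matrix invariant under `S_N` is a linear combination of the `D_π`. -/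
theorem exists_realize_eq (M : Matrix (Fin k → Fin N) (Fin k → Fin N) ℂ)
    (hM : ∀ (s : Equiv.Perm (Fin N)) J I, M (fun l => s (J l)) (fun l => s (I l)) = M J I) :
    ∃ d : PartAlg k, realize N d = M := by
  classical
  -- The orbits of `S_N` on pairs of labellings are the level-set classes, so `M` is constant on
  -- each. When there are too few labels to realize `r`, the class is empty and the value `0` is
  -- arbitrary.
  have hm : ∀ r : Diagram k, ∃ c : ℂ, ∀ J I, r = Setoid.ker (Sum.elim I J) → M J I = c := by
    intro r
    by_cases h : ∃ J I : Fin k → Fin N, r = Setoid.ker (Sum.elim I J)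
    · obtain ⟨J₀, I₀, h₀⟩ := h
      refine ⟨M J₀ I₀, fun J I h => ?_⟩
      obtain ⟨s, hs⟩ := exists_perm_comp_eq (h₀.symm.trans h)
      rw [← hM s J₀ I₀]
      congr 1
      · exact funext fun l => (hs (Sum.inr l)).symm
      · exact funext fun l => (hs (Sum.inl l)).symm
    · exact ⟨0, fun J I hJI => absurd ⟨J, I, hJI⟩ h⟩
  choose m hm using hm
  have hsum : M = ∑ r, m r • blockMatrix N r := by
    ext J I
    rw [Matrix.sum_apply, Finset.sum_eq_single (Setoid.ker (Sum.elim I J))]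
    · simp [blockMatrix, hm _ J I rfl]
    · intro s _ hs
      simp [blockMatrix, hs]
    · simp
  have : M ∈ Submodule.span ℂ (Set.range (diagMatrix N (k := k))) := by
    rw [hsum]
    exact Submodule.sum_mem _ fun r _ => Submodule.smul_mem _ _ (blockMatrix_mem_span r)
  exact (Submodule.mem_span_range_iff_exists_fun ℂ).mp this

/-- The `D_π` are linearly independent as soon as the `2k` vertices can get distinct labels. -/
theorem realize_eq_zero (hN : 2 * k ≤ N) (d : PartAlg k) (hd : realize N d = 0) : d = 0 := by
  classical
  funext r
  induction r using WellFoundedLT.induction with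
  | ind r ih =>
    have hcard : Nat.card (Quotient r) ≤ Nat.card (Fin N) := by
      have := Nat.card_le_card_of_surjective (Quotient.mk r) Quotient.mk_surjective
      simp only [Nat.card_sum, Nat.card_fin] at this ⊢
      lia
    have := Fintype.ofFinite (Quotient r)
    rw [Nat.card_eq_fintype_card, Nat.card_eq_fintype_card] at hcard
    obtain ⟨e⟩ := Function.Embedding.nonempty_of_card_le hcard
    -- For a labelling with level sets exactly the blocks of `r`, only `s ≤ r` contribute, and the
    -- coefficients with `s < r` vanish by induction. Such a labelling exists because `r` has at
    -- most `2k` blocks.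
    let K : Fin k ⊕ Fin k → Fin N := fun x => e (Quotient.mk r x)
    have hK : Setoid.ker (Sum.elim (K ∘ Sum.inl) (K ∘ Sum.inr)) = r := by
      rw [Sum.elim_comp_inl_inr]
      ext x y
      simp only [K, Setoid.ker_def, e.injective.eq_iff]
      exact Quotient.eq
    have h := congrFun (congrFun hd (K ∘ Sum.inr)) (K ∘ Sum.inl)
    rw [realize, Matrix.sum_apply, Finset.sum_eq_single r] at h
    · rw [Matrix.smul_apply, diagMatrix_eq, hK, if_pos le_rfl] at h
      simpa using h
    · intro s _ hs
      rw [Matrix.smul_apply, diagMatrix_eq, hK]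
      split_ifs with hsr
      · simp [ih s (lt_of_le_of_ne hsr hs)]
      · simp
    · simp

theorem diagMatrix_transpose (r : Diagram k) (J I : Fin k → Fin N) :
    diagMatrix N r.transpose J I = diagMatrix N r I J := by
  classical
  rw [diagMatrix_eq, diagMatrix_eq]
  congr 1
  rw [Setoid.le_def, Setoid.le_def, eq_iff_iff]
  refine ⟨fun h x y hxy => ?_, fun h x y hxy => ?_⟩
  · have := @h x.swap y.swap (by simpa [Diagram.transpose, Setoid.comap_rel] using hxy)
    rcases x with x | x <;> rcases y with y | y <;> simpa using this
  · have := h (Setoid.comap_rel _ _ _ _ |>.mp hxy)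
    rcases x with x | x <;> rcases y with y | y <;> simpa using this

theorem realize_transpose (d : PartAlg k) :
    (realize N d).transpose = realize N fun r => d r.transpose := by
  have hi : Function.Involutive (Diagram.transpose (k := k)) := fun r => by
    ext x y
    simp [Setoid.comap_rel]
  ext J I
  simp only [realize, Matrix.transpose_apply, Matrix.sum_apply, Matrix.smul_apply]
  refine Fintype.sum_equiv hi.toPerm _ _ fun r => ?_
  simp only [Function.Involutive.coe_toPerm, diagMatrix_transpose]
  rw [hi r]

/-- The span of the `D_π` is closed under adjoints, so nondegeneracy of the trace form reduces to
positivity of `Tr(X† X)`. -/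
theorem realize_conjTranspose (d : PartAlg k) :
    (realize N d).conjTranspose = realize N fun r => star (d r.transpose) := by
  rw [Matrix.conjTranspose, realize_transpose]
  ext J I
  simp only [realize, Matrix.map_apply, Matrix.sum_apply, Matrix.smul_apply, star_sum, smul_eq_mul,
    star_mul']
  refine Finset.sum_congr rfl fun r _ => ?_
  congr 1
  simp only [diagMatrix]
  split_ifs <;> simp

theorem gram_mulVec (d : PartAlg k) (r : Diagram k) :
    (gram N k).mulVec d r = (diagMatrix N r * realize N d).trace := by
  simp only [Matrix.mulVec, dotProduct, gram, Matrix.of_apply, realize, Matrix.mul_sum,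
    Matrix.trace_sum, Matrix.mul_smul, Matrix.trace_smul, smul_eq_mul]
  exact Finset.sum_congr rfl fun s _ => mul_comm _ _

theorem gram_transpose : (gram N k).transpose = gram N k :=
  Matrix.ext fun r s => by
    rw [Matrix.transpose_apply, gram, Matrix.of_apply, Matrix.of_apply, Matrix.trace_mul_comm]

open scoped ComplexOrder in
/-- The Gram matrix of the diagram basis is invertible for `N ≥ 2k`. -/
theorem isUnit_gram (hN : 2 * k ≤ N) : IsUnit (gram N k) := by
  rw [← Matrix.mulVec_injective_iff_isUnit]
  refine (injective_iff_map_eq_zero (Matrix.mulVecLin (gram N k))).mpr ?_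
  intro d hd
  refine realize_eq_zero hN d ?_
  -- For `d` in the kernel, `X = realize N d` is trace-orthogonal to every diagram, hence to its own
  -- adjoint.
  rw [← Matrix.trace_conjTranspose_mul_self_eq_zero_iff, realize_conjTranspose]
  have h : ∀ r, (diagMatrix N r * realize N d).trace = 0 := fun r => by
    rw [← gram_mulVec]
    exact congrFun hd r
  conv_lhs => enter [1, 1]; rw [realize]
  simp [Finset.sum_mul, Matrix.trace_sum, h]

/-- The defining property of the dual basis. -/
theorem sum_realize_dual_mul (hN : 2 * k ≤ N) (r : Diagram k) (d : PartAlg k) :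
    ∑ J, ∑ I, realize N (dual N r) J I * realize N d J I = d r := by
  have hdual : realize N (dual N r) =
      ∑ s, (gram N k)⁻¹ s r • diagMatrix N s.transpose := by
    ext J I
    simp only [realize, dual, Matrix.sum_apply, Matrix.smul_apply, Finset.sum_apply, Pi.smul_apply,
      smul_eq_mul, Finset.sum_mul]
    rw [Finset.sum_comm]
    refine Finset.sum_congr rfl fun s _ => ?_
    rw [Finset.sum_eq_single s.transpose] <;> simp +contextual
  -- The transpose in the dual element converts the entrywise pairing into a trace.
  have htr : ∑ J, ∑ I, realize N (dual N r) J I * realize N d J I =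
      ∑ s, (gram N k)⁻¹ s r * (diagMatrix N s * realize N d).trace := by
    have h : ∀ s : Diagram k, (diagMatrix N s * realize N d).trace =
        ∑ J, ∑ I, diagMatrix N s.transpose J I * realize N d J I := fun s => by
      simp only [Matrix.trace, Matrix.diag, Matrix.mul_apply, diagMatrix_transpose]
      exact Finset.sum_comm
    have hc : ∀ (c : ℂ) (A : Matrix (Fin k → Fin N) (Fin k → Fin N) ℂ),
        c * ∑ J, ∑ I, A J I * realize N d J I = ∑ J, ∑ I, c * A J I * realize N d J I := by
      intro c A
      simp only [Finset.mul_sum, mul_assoc]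
    simp only [hdual, Matrix.sum_apply, Matrix.smul_apply, smul_eq_mul, h, hc, Finset.sum_mul]
    refine Eq.trans (Finset.sum_congr rfl fun J _ => Finset.sum_comm) ?_
    exact Finset.sum_comm
  have hinv : (gram N k)⁻¹ * gram N k = 1 :=
    Matrix.nonsing_inv_mul _ ((Matrix.isUnit_iff_isUnit_det _).mp (isUnit_gram hN))
  -- The dual element sums over the first index of `g⁻¹`; symmetry lets the sum be read as `g⁻¹ (g
  -- d)`.
  have hsymm : (gram N k)⁻¹.transpose = (gram N k)⁻¹ := by
    rw [Matrix.transpose_nonsing_inv, gram_transpose]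
  have hd : (gram N k)⁻¹.mulVec ((gram N k).mulVec d) = d := by
    rw [Matrix.mulVec_mulVec, hinv, Matrix.one_mulVec]
  rw [htr]
  conv_rhs => rw [← hd, ← hsymm]
  simp only [Matrix.mulVec_transpose, Matrix.vecMul, dotProduct, gram_mulVec, mul_comm]

/-! ### Orthonormal copies of `V_λ` in `V_N^{⊗ k}` and the operators of the matrix units -/

section Copies

variable {N k : ℕ} {lam : N.Partition}

theorem tensorRep_apply (s : Equiv.Perm (Fin N)) (x : TensorPow N k) (I : Fin k → Fin N) :
    tensorRep N k s x I = x fun l => s⁻¹ (I l) := rfl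

/-- `S_N` permutes the standard basis, so it preserves the bilinear dot product. Since the
Clebsch–Gordan coordinates are real, this form can replace the Hermitian one. -/
theorem tensorRep_dotProduct (s : Equiv.Perm (Fin N)) (x y : TensorPow N k) :
    x ⬝ᵥ tensorRep N k s y = tensorRep N k s⁻¹ x ⬝ᵥ y := by
  refine Fintype.sum_equiv (Equiv.arrowCongr (Equiv.refl (Fin k)) s⁻¹) _ _ fun I => ?_
  rw [tensorRep_apply, tensorRep_apply, inv_inv]
  congr 2
  funext l
  simp

variable {ι : Type*} [Fintype ι] [DecidableEq ι] (e : Module.Basis ι ℂ (Specht lam))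

/-- The orthogonal projection of `V_N^{⊗ k}` to an orthonormal copy of `V_λ`. -/
def coprojLin (f : Mult k lam) : TensorPow N k →ₗ[ℂ] Specht lam where
  toFun w := ∑ a, (f (e a) ⬝ᵥ w) • e a
  map_add' v w := by simp [dotProduct_add, add_smul, Finset.sum_add_distrib]
  map_smul' c w := by simp [dotProduct_smul, Finset.smul_sum, smul_smul]

variable {e} {f : Mult k lam}

theorem coprojLin_apply_self (hf : ∀ a b, f (e a) ⬝ᵥ f (e b) = if a = b then 1 else 0)
    (v : Specht lam) : coprojLin e f (f v) = v := by
  have : (coprojLin e f).comp f.toLinearMap = LinearMap.id := by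
    refine e.ext fun b => ?_
    change ∑ a, (f (e a) ⬝ᵥ f (e b)) • e a = e b
    simp [hf]
  exact LinearMap.congr_fun this v

theorem dotProduct_coprojLin (hf : ∀ a b, f (e a) ⬝ᵥ f (e b) = if a = b then 1 else 0)
    (v : Specht lam) (w : TensorPow N k) : f v ⬝ᵥ f (coprojLin e f w) = f v ⬝ᵥ w := by
  have h : ∀ b, f (e b) ⬝ᵥ f (coprojLin e f w) = f (e b) ⬝ᵥ w := by
    intro b
    change f (e b) ⬝ᵥ f (∑ a, (f (e a) ⬝ᵥ w) • e a) = _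
    simp [map_sum, dotProduct_sum, dotProduct_smul, hf]
  rw [← e.sum_repr v]
  simp only [map_sum, map_smul, sum_dotProduct, smul_dotProduct, h]

/-- The coefficients of the projection are dot products with the image of `f`, which is
`S_N`-stable; orthogonality of the action moves `s` across them. -/
theorem coprojLin_equivariant (hf : ∀ a b, f (e a) ⬝ᵥ f (e b) = if a = b then 1 else 0)
    (s : Equiv.Perm (Fin N)) (w : TensorPow N k) :
    coprojLin e f (tensorRep N k s w) = spechtRep lam s (coprojLin e f w) := by
  have h : ∀ v, f v ⬝ᵥ tensorRep N k s w = f v ⬝ᵥ f (spechtRep lam s (coprojLin e f w)) := by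
    intro v
    rw [f.isIntertwining, tensorRep_dotProduct, tensorRep_dotProduct, ← f.isIntertwining,
      dotProduct_coprojLin hf]
  rw [← coprojLin_apply_self hf (spechtRep lam s (coprojLin e f w))]
  change ∑ a, (f (e a) ⬝ᵥ _) • e a = ∑ a, (f (e a) ⬝ᵥ _) • e a
  simp only [h]

/-- The orthogonal projection to an orthonormal copy of `V_λ` as an equivariant map. -/
def coproj (hf : ∀ a b, f (e a) ⬝ᵥ f (e b) = if a = b then 1 else 0) :
    Representation.IntertwiningMap (tensorRep N k) (spechtRep lam) :=
  (coprojLin e f).intertwiningMap_of_isIntertwiningMap _ _ (coprojLin_equivariant hf)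

theorem coproj_apply (hf : ∀ a b, f (e a) ⬝ᵥ f (e b) = if a = b then 1 else 0)
    (w : TensorPow N k) : coproj hf w = ∑ a, (f (e a) ⬝ᵥ w) • e a := rfl

theorem coproj_apply_self (hf : ∀ a b, f (e a) ⬝ᵥ f (e b) = if a = b then 1 else 0)
    (v : Specht lam) : coproj hf (f v) = v := coprojLin_apply_self hf v

/-- An equivariant endomorphism of `V_N^{⊗ k}` is given by an element of the partition algebra. -/
theorem exists_realize_mulVec (X : Representation.IntertwiningMap (tensorRep N k) (tensorRep N k)) :
    ∃ d : PartAlg k, ∀ w, X w = (realize N d).mulVec w := by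
  obtain ⟨d, hd⟩ := exists_realize_eq (LinearMap.toMatrix' X.toLinearMap) (by
    intro s J I
    have h : tensorRep N k s (Pi.single I 1) = Pi.single (fun l => s (I l)) 1 := by
      ext K
      rw [tensorRep_apply, Pi.single_apply, Pi.single_apply]
      congr 1
      rw [eq_iff_iff, funext_iff, funext_iff]
      exact forall_congr' fun l => by rw [Equiv.Perm.inv_eq_iff_eq]
    rw [LinearMap.toMatrix'_apply, LinearMap.toMatrix'_apply, X.toLinearMap_apply,
      X.toLinearMap_apply, ← h, X.isIntertwining, tensorRep_apply]
    simp)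
  refine ⟨d, fun w => ?_⟩
  rw [hd, LinearMap.toMatrix'_mulVec]
  rfl

namespace ClebschGordan

variable (C : ClebschGordan k lam)

theorem dotProduct_eq (a b α β) :
    C.mult α (C.irr a) ⬝ᵥ C.mult β (C.irr b) = if a = b ∧ α = β then 1 else 0 := by
  rw [← C.orthonormal a b α β]
  simp only [C.real, dotProduct]

theorem dotProduct_self (α a b) :
    C.mult α (C.irr a) ⬝ᵥ C.mult α (C.irr b) = if a = b then 1 else 0 := by
  simp [C.dotProduct_eq]

end ClebschGordan

theorem partAct_apply (d : PartAlg k) (f : Mult k lam) (v : Specht lam) :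
    partAct lam d f v = (realize N d).mulVec (f v) := by
  simp only [partAct, realize, LinearMap.sum_apply, LinearMap.smul_apply,
    Representation.IntertwiningMap.sum_apply, Matrix.sum_mulVec, Matrix.smul_mulVec]
  exact Finset.sum_congr rfl fun r _ => rfl

/-- The matrix unit `Q^λ_{αβ}` acts on `V_N^{⊗ k}` as `∑_a |E_a ⊗ E_α⟩⟨E_a ⊗ E_β|`. -/
theorem realize_matrixUnit (hN : 2 * k ≤ N) (C : ClebschGordan k lam) (α β) (J I) :
    realize N (matrixUnit C α β) J I =
      ∑ a, C.mult α (C.irr a) J * C.mult β (C.irr a) I := by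
  -- The right-hand side is the matrix of the equivariant map `E_α ∘ E_β†`, so it is realized by
  -- some `c`; the dual basis then extracts the coefficients of `c`.
  obtain ⟨c, hc⟩ := exists_realize_mulVec
    ((C.mult α).comp (coproj (C.dotProduct_self β)))
  have hc' : ∀ J I, realize N c J I = ∑ a, C.mult α (C.irr a) J * C.mult β (C.irr a) I := by
    intro J I
    have := congrFun (hc (Pi.single I 1)) J
    rw [Matrix.mulVec_single_one] at this
    refine this.symm.trans ?_
    rw [Representation.IntertwiningMap.comp_apply, coproj_apply]
    simp only [map_sum, map_smul, dotProduct_single_one, Finset.sum_apply, Pi.smul_apply,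
      smul_eq_mul]
    exact Finset.sum_congr rfl fun a _ => mul_comm _ _
  suffices h : matrixUnit C α β = c by rw [h, hc']
  funext r
  rw [← sum_realize_dual_mul hN r c, matrixUnit]
  generalize dual N r = d
  have hd : ∀ v, (realize N d).mulVec (C.mult β v) =
      ∑ γ, LinearMap.toMatrix C.mult C.mult (partAct lam d) γ β • C.mult γ v := by
    intro v
    rw [← partAct_apply, ← C.mult.sum_repr (partAct lam d (C.mult β)),
      Representation.IntertwiningMap.sum_apply]
    exact Finset.sum_congr rfl fun γ _ => by rw [LinearMap.toMatrix_apply]; rfl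
  -- Each `a` contributes the same entry `D_{αβ}`, which accounts for the factor `dim V_λ`.
  calc (Module.finrank ℂ (Specht lam) : ℂ) * LinearMap.toMatrix C.mult C.mult (partAct lam d) α β
      = ∑ a, C.mult α (C.irr a) ⬝ᵥ (realize N d).mulVec (C.mult β (C.irr a)) := by
        simp [hd, dotProduct_sum, dotProduct_smul, C.dotProduct_eq]
    _ = _ := by
        simp only [hc', dotProduct, Matrix.mulVec, Finset.mul_sum]
        rw [Finset.sum_comm]
        refine Finset.sum_congr rfl fun J _ => ?_
        rw [Finset.sum_comm]
        exact Finset.sum_congr rfl fun I _ => Finset.sum_congr rfl fun a _ => by ring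

end Copies

/-! ### The isomorphism `V_N^{⊗ k₁} ⊗ V_N^{⊗ k₂} ≅ V_N^{⊗ (k₁ + k₂)}` -/

section Join

variable {N k₁ k₂ : ℕ}

/-- The multiplication `V_N^{⊗ k₁} ⊗ V_N^{⊗ k₂} → V_N^{⊗ (k₁ + k₂)}`. -/
def joinLin (N k₁ k₂ : ℕ) :
    TensorPow N k₁ ⊗[ℂ] TensorPow N k₂ →ₗ[ℂ] TensorPow N (k₁ + k₂) :=
  TensorProduct.lift (LinearMap.mk₂ ℂ
    (fun x y J => x (fun l => J (Fin.castAdd k₂ l)) * y (fun l => J (Fin.natAdd k₁ l)))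
    (fun x x' y => by ext J; simp [add_mul])
    (fun c x y => by ext J; simp [mul_assoc])
    (fun x y y' => by ext J; simp [mul_add])
    (fun c x y => by ext J; simp [mul_left_comm]))

@[simp]
theorem joinLin_tmul (x : TensorPow N k₁) (y : TensorPow N k₂) (J : Fin (k₁ + k₂) → Fin N) :
    joinLin N k₁ k₂ (x ⊗ₜ y) J =
      x (fun l => J (Fin.castAdd k₂ l)) * y (fun l => J (Fin.natAdd k₁ l)) := rfl

/-- The inverse of `joinLin`. -/
def splitLin (N k₁ k₂ : ℕ) :
    TensorPow N (k₁ + k₂) →ₗ[ℂ] TensorPow N k₁ ⊗[ℂ] TensorPow N k₂ where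
  toFun w := ∑ J : Fin (k₁ + k₂) → Fin N,
    w J • ((Pi.single (fun l => J (Fin.castAdd k₂ l)) 1 : TensorPow N k₁) ⊗ₜ[ℂ]
      (Pi.single (fun l => J (Fin.natAdd k₁ l)) 1 : TensorPow N k₂))
  map_add' v w := by simp [add_smul, Finset.sum_add_distrib]
  map_smul' c w := by simp [Finset.smul_sum, smul_smul]

theorem splitLin_apply (w : TensorPow N (k₁ + k₂)) :
    splitLin N k₁ k₂ w = ∑ J : Fin (k₁ + k₂) → Fin N,
      w J • ((Pi.single (fun l => J (Fin.castAdd k₂ l)) 1 : TensorPow N k₁) ⊗ₜ[ℂ]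
        (Pi.single (fun l => J (Fin.natAdd k₁ l)) 1 : TensorPow N k₂)) := rfl

theorem joinLin_single (J : Fin (k₁ + k₂) → Fin N) :
    joinLin N k₁ k₂ ((Pi.single (fun l => J (Fin.castAdd k₂ l)) 1 : TensorPow N k₁) ⊗ₜ[ℂ]
        (Pi.single (fun l => J (Fin.natAdd k₁ l)) 1 : TensorPow N k₂)) = Pi.single J 1 := by
  ext K
  rw [joinLin_tmul, Pi.single_apply, Pi.single_apply, Pi.single_apply, ite_zero_mul_ite_zero,
    one_mul]
  congr 1
  rw [eq_iff_iff, funext_iff, funext_iff, funext_iff, Fin.forall_fin_add]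

theorem splitLin_single (J : Fin (k₁ + k₂) → Fin N) :
    splitLin N k₁ k₂ (Pi.single J 1) =
      (Pi.single (fun l => J (Fin.castAdd k₂ l)) 1 : TensorPow N k₁) ⊗ₜ[ℂ]
        (Pi.single (fun l => J (Fin.natAdd k₁ l)) 1 : TensorPow N k₂) := by
  rw [splitLin_apply, Finset.sum_eq_single J]
  · simp
  · intro K _ hK
    simp [hK]
  · simp

/-- `V_N^{⊗ k₁} ⊗ V_N^{⊗ k₂} ≅ V_N^{⊗ (k₁ + k₂)}` as representations of `S_N`. -/
def joinEquiv (N k₁ k₂ : ℕ) :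
    ((tensorRep N k₁).tprod (tensorRep N k₂)).Equiv (tensorRep N (k₁ + k₂)) :=
  .mk (LinearEquiv.ofLinearMap (joinLin N k₁ k₂) (splitLin N k₁ k₂)
    (by
      refine (Pi.basisFun ℂ _).ext fun J => ?_
      rw [Pi.basisFun_apply, LinearMap.comp_apply, splitLin_single, joinLin_single]
      rfl)
    (by
      refine ((Pi.basisFun ℂ _).tensorProduct (Pi.basisFun ℂ _)).ext fun IJ => ?_
      obtain ⟨K, rfl⟩ := (Fin.appendEquiv k₁ k₂).symm.surjective IJ
      rw [Module.Basis.tensorProduct_apply, Pi.basisFun_apply, Pi.basisFun_apply,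
        LinearMap.comp_apply]
      exact (congrArg _ (joinLin_single K)).trans (splitLin_single K)))
    (fun s => by
      refine TensorProduct.ext' fun x y => ?_
      rfl)

theorem joinEquiv_symm_apply (w : TensorPow N (k₁ + k₂)) :
    (joinEquiv N k₁ k₂).symm w = ∑ J : Fin (k₁ + k₂) → Fin N,
      w J • ((Pi.single (fun l => J (Fin.castAdd k₂ l)) 1 : TensorPow N k₁) ⊗ₜ[ℂ]
        (Pi.single (fun l => J (Fin.natAdd k₁ l)) 1 : TensorPow N k₂)) := rfl

theorem sumElim_eq_splitVertex (I J : Fin (k₁ + k₂) → Fin N) (x) :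
    Sum.elim I J x = Sum.elim
      (Sum.elim (fun l => I (Fin.castAdd k₂ l)) (fun l => J (Fin.castAdd k₂ l)))
      (Sum.elim (fun l => I (Fin.natAdd k₁ l)) (fun l => J (Fin.natAdd k₁ l)))
      (splitVertex k₁ k₂ x) := by
  rcases x with x | x <;> induction x using Fin.addCases <;> simp [splitVertex]

/-- No block of a concatenated diagram joins the two halves, so the label constraints decouple. -/
theorem tensor_le_ker_iff (r : Diagram k₁) (s : Diagram k₂) (I J : Fin (k₁ + k₂) → Fin N) :
    r.tensor s ≤ Setoid.ker (Sum.elim I J) ↔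
      r ≤ Setoid.ker (Sum.elim (fun l => I (Fin.castAdd k₂ l)) (fun l => J (Fin.castAdd k₂ l))) ∧
      s ≤ Setoid.ker (Sum.elim (fun l => I (Fin.natAdd k₁ l)) (fun l => J (Fin.natAdd k₁ l))) := by
  simp only [Setoid.le_def, Setoid.ker_def]
  constructor
  · intro h
    refine ⟨fun {x y} hxy => ?_, fun {x y} hxy => ?_⟩
    · have e : ∀ z, splitVertex k₁ k₂ (Sum.map (Fin.castAdd k₂) (Fin.castAdd k₂) z) = Sum.inl z := by
        rintro (z | z) <;> simp [splitVertex]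
      have := @h (Sum.map (Fin.castAdd k₂) (Fin.castAdd k₂) x)
        (Sum.map (Fin.castAdd k₂) (Fin.castAdd k₂) y) (by
          rw [Diagram.tensor, Setoid.comap_rel, e, e]
          exact Sum.LiftRel.inl hxy)
      rwa [sumElim_eq_splitVertex, sumElim_eq_splitVertex I J, e, e] at this
    · have e : ∀ z, splitVertex k₁ k₂ (Sum.map (Fin.natAdd k₁) (Fin.natAdd k₁) z) = Sum.inr z := by
        rintro (z | z) <;> simp [splitVertex]
      have := @h (Sum.map (Fin.natAdd k₁) (Fin.natAdd k₁) x)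
        (Sum.map (Fin.natAdd k₁) (Fin.natAdd k₁) y) (by
          rw [Diagram.tensor, Setoid.comap_rel, e, e]
          exact Sum.LiftRel.inr hxy)
      rwa [sumElim_eq_splitVertex, sumElim_eq_splitVertex I J, e, e] at this
  · rintro ⟨h₁, h₂⟩ x y hxy
    rw [sumElim_eq_splitVertex, sumElim_eq_splitVertex I J]
    change Sum.LiftRel r s (splitVertex k₁ k₂ x) (splitVertex k₁ k₂ y) at hxy
    generalize splitVertex k₁ k₂ x = x at hxy
    generalize splitVertex k₁ k₂ y = y at hxy
    rcases hxy with hxy | hxy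
    · exact h₁ hxy
    · exact h₂ hxy

theorem diagMatrix_tensor (r : Diagram k₁) (s : Diagram k₂) (J I : Fin (k₁ + k₂) → Fin N) :
    diagMatrix N (r.tensor s) J I =
      diagMatrix N r (fun l => J (Fin.castAdd k₂ l)) (fun l => I (Fin.castAdd k₂ l)) *
      diagMatrix N s (fun l => J (Fin.natAdd k₁ l)) (fun l => I (Fin.natAdd k₁ l)) := by
  classical
  rw [diagMatrix_eq, diagMatrix_eq, diagMatrix_eq, ite_zero_mul_ite_zero, one_mul]
  exact if_congr (tensor_le_ker_iff r s I J) rfl rfl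

/-- This compatibility puts the maps of `branchOfIntertwiner` inside `branchHom`. -/
theorem diagMap_tensor_joinEquiv (r : Diagram k₁) (s : Diagram k₂)
    (t : TensorPow N k₁ ⊗[ℂ] TensorPow N k₂) :
    diagMap N (r.tensor s) (joinEquiv N k₁ k₂ t) =
      joinEquiv N k₁ k₂ ((diagMap N r).tensor (diagMap N s) t) := by
  have h : (diagMap N (r.tensor s)).toLinearMap ∘ₗ (joinEquiv N k₁ k₂).toLinearMap =
      (joinEquiv N k₁ k₂).toLinearMap ∘ₗ ((diagMap N r).tensor (diagMap N s)).toLinearMap := by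
    refine TensorProduct.ext' fun x y => ?_
    ext J
    change ∑ I, diagMatrix N (r.tensor s) J I * (_ * _) =
      (∑ I₁, diagMatrix N r _ I₁ * x I₁) * ∑ I₂, diagMatrix N s _ I₂ * y I₂
    rw [Finset.sum_mul_sum, ← Fintype.sum_prod_type']
    refine Fintype.sum_equiv (Fin.appendEquiv k₁ k₂).symm _ _ fun I => ?_
    rw [diagMatrix_tensor]
    simp only [Fin.appendEquiv_symm_apply]
    ring
  exact LinearMap.congr_fun h t

end Join

/-! ### The branching multiplicity -/

section BranchingMultiplicity

variable {N k₁ k₂ : ℕ} {lam lam' lam'' : N.Partition}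

/-- An intertwiner `V_λ → V_λ' ⊗ V_λ''` composed with embeddings of `V_λ'` and `V_λ''`. -/
def embedTensor (f' : Mult k₁ lam') (f'' : Mult k₂ lam'') :
    Representation.IntertwiningMap (spechtRep lam) ((spechtRep lam').tprod (spechtRep lam'')) →ₗ[ℂ]
      Mult (k₁ + k₂) lam :=
  Representation.IntertwiningMap.llcomp _ _ _
    ((joinEquiv N k₁ k₂).toIntertwiningMap.comp (f'.tensor f''))

theorem embedTensor_apply (f' : Mult k₁ lam') (f'' : Mult k₂ lam'')
    (φ : Representation.IntertwiningMap (spechtRep lam)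
      ((spechtRep lam').tprod (spechtRep lam''))) (v : Specht lam) :
    embedTensor f' f'' φ v = joinEquiv N k₁ k₂ (f'.tensor f'' (φ v)) := rfl

/-- The map `Hom_{S_N}(V_λ, V_λ' ⊗ V_λ'') → Hom(Z_λ' ⊗ Z_λ'', Z_λ)` sending `φ` to
`f' ⊗ f'' ↦ (f' ⊗ f'') ∘ φ`. -/
def branchOfIntertwiner (k₁ k₂ : ℕ) (lam lam' lam'' : N.Partition) :
    Representation.IntertwiningMap (spechtRep lam) ((spechtRep lam').tprod (spechtRep lam'')) →ₗ[ℂ]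
      branchHom k₁ k₂ lam lam' lam'' where
  toFun φ := ⟨TensorProduct.lift (LinearMap.mk₂ ℂ
    (fun (f' : Mult k₁ lam') (f'' : Mult k₂ lam'') => embedTensor f' f'' φ)
    (fun f g h => by
      rw [embedTensor, Representation.IntertwiningMap.tensor_add_left,
        Representation.IntertwiningMap.add_comp, map_add]; rfl)
    (fun c f h => by
      rw [embedTensor, Representation.IntertwiningMap.tensor_smul_left,
        Representation.IntertwiningMap.comp_smul, map_smul]; rfl)
    (fun f g h => by
      rw [embedTensor, Representation.IntertwiningMap.tensor_add_right,
        Representation.IntertwiningMap.add_comp, map_add]; rfl)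
    (fun c f h => by
      rw [embedTensor, Representation.IntertwiningMap.tensor_smul_right,
        Representation.IntertwiningMap.comp_smul, map_smul]; rfl)), by
    intro r s
    refine TensorProduct.ext' fun f' f'' => DFunLike.ext _ _ fun v => ?_
    change joinEquiv N k₁ k₂ (TensorProduct.map ((diagMap N r).toLinearMap ∘ₗ f'.toLinearMap)
      ((diagMap N s).toLinearMap ∘ₗ f''.toLinearMap) (φ v)) =
        diagMap N (r.tensor s) (joinEquiv N k₁ k₂ (f'.tensor f'' (φ v)))
    rw [diagMap_tensor_joinEquiv, TensorProduct.map_comp]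
    rfl⟩
  map_add' φ ψ := Subtype.ext <| TensorProduct.ext' fun f' f'' => map_add (embedTensor f' f'') φ ψ
  map_smul' c φ := Subtype.ext <| TensorProduct.ext' fun f' f'' =>
    map_smul (embedTensor f' f'') c φ

theorem branchOfIntertwiner_apply (φ : Representation.IntertwiningMap (spechtRep lam)
      ((spechtRep lam').tprod (spechtRep lam''))) (f' : Mult k₁ lam') (f'' : Mult k₂ lam'') :
    (branchOfIntertwiner k₁ k₂ lam lam' lam'' φ).1 (f' ⊗ₜ f'') =
      embedTensor f' f'' φ := rfl

/-- A map commuting with `P_{k₁}(N) ⊗ P_{k₂}(N)` commutes with all pairs of equivariant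
endomorphisms. -/
theorem branchHom_comp (F : branchHom k₁ k₂ lam lam' lam'')
    (X : Representation.IntertwiningMap (tensorRep N k₁) (tensorRep N k₁))
    (Y : Representation.IntertwiningMap (tensorRep N k₂) (tensorRep N k₂))
    (f' : Mult k₁ lam') (f'' : Mult k₂ lam'') (v : Specht lam) :
    F.1 (X.comp f' ⊗ₜ Y.comp f'') v =
      joinEquiv N k₁ k₂ (X.tensor Y ((joinEquiv N k₁ k₂).symm
        (F.1 (f' ⊗ₜ f'') v))) := by
  -- Both sides are bilinear in `X` and `Y`, and diagrams span; for a pair of diagrams the identity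
  -- is the condition defining `branchHom`.
  have hX : ∀ {k : ℕ} (X : Representation.IntertwiningMap (tensorRep N k) (tensorRep N k)),
      ∃ d : PartAlg k, X = ∑ r, d r • diagMap N r := by
    intro k X
    obtain ⟨d, hd⟩ := exists_realize_mulVec X
    refine ⟨d, DFunLike.ext _ _ fun w => ?_⟩
    rw [hd, Representation.IntertwiningMap.sum_apply, realize, Matrix.sum_mulVec]
    exact Finset.sum_congr rfl fun r _ => Matrix.smul_mulVec _ _ _
  obtain ⟨c, rfl⟩ := hX X
  obtain ⟨d, rfl⟩ := hX Y
  have h : ∀ r s, F.1 (diagAct lam' r f' ⊗ₜ diagAct lam'' s f'') v =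
      joinEquiv N k₁ k₂ ((diagMap N r).tensor (diagMap N s) ((joinEquiv N k₁ k₂).symm
        (F.1 (f' ⊗ₜ f'') v))) := by
    intro r s
    have := DFunLike.congr_fun (LinearMap.congr_fun (F.2 r s) (f' ⊗ₜ f'')) v
    refine this.trans ?_
    rw [← diagMap_tensor_joinEquiv, Representation.Equiv.apply_symm_apply]
    rfl
  have e₁ : ∀ {k : ℕ} {l : N.Partition} (c : PartAlg k) (f : Mult k l),
      (∑ r, c r • diagMap N r).comp f = ∑ r, c r • diagAct l r f := by
    intro k l c f
    rw [Representation.IntertwiningMap.comp_def, map_sum, LinearMap.sum_apply]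
    rfl
  have e₂ : (∑ r, c r • diagMap N r).tensor (∑ s, d s • diagMap N s) =
      ∑ r, ∑ s, (c r * d s) • (diagMap N r).tensor (diagMap N s) := by
    refine Representation.IntertwiningMap.ext (TensorProduct.ext' fun x y => ?_)
    simp only [Representation.IntertwiningMap.toLinearMap_apply,
      Representation.IntertwiningMap.tensor_apply, Representation.IntertwiningMap.sum_apply,
      Representation.IntertwiningMap.smul_apply, TensorProduct.sum_tmul, TensorProduct.tmul_sum,
      TensorProduct.smul_tmul_smul]
    exact Finset.sum_comm
  rw [e₁, e₁, e₂, TensorProduct.sum_tmul]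
  simp only [TensorProduct.tmul_sum, TensorProduct.smul_tmul_smul, map_sum, map_smul,
    Representation.IntertwiningMap.sum_apply, Representation.IntertwiningMap.smul_apply, h]

/-- If `V_λ'` and `V_λ''` have equivariant retractions from `V_N^{⊗ k₁}` and `V_N^{⊗ k₂}`, then
every map commuting with `P_{k₁}(N) ⊗ P_{k₂}(N)` comes from a unique intertwiner. -/
theorem branchOfIntertwiner_bijective (f' : Mult k₁ lam') (f'' : Mult k₂ lam'')
    (g' : Representation.IntertwiningMap (tensorRep N k₁) (spechtRep lam'))
    (g'' : Representation.IntertwiningMap (tensorRep N k₂) (spechtRep lam''))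
    (h' : ∀ v, g' (f' v) = v) (h'' : ∀ v, g'' (f'' v) = v) :
    Function.Bijective (branchOfIntertwiner k₁ k₂ lam lam' lam'') := by
  have hg : ∀ t, g'.tensor g'' (f'.tensor f'' t) = t := by
    intro t
    have : (g'.tensor g'').toLinearMap ∘ₗ (f'.tensor f'').toLinearMap = LinearMap.id :=
      TensorProduct.ext' fun x y => by
        change g' (f' x) ⊗ₜ g'' (f'' y) = x ⊗ₜ y
        rw [h', h'']
    exact LinearMap.congr_fun this t
  constructor
  · have key : ∀ φ v, φ v = g'.tensor g'' ((joinEquiv N k₁ k₂).symm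
        ((branchOfIntertwiner k₁ k₂ lam lam' lam'' φ).1 (f' ⊗ₜ f'') v)) := by
      intro φ v
      rw [branchOfIntertwiner_apply, embedTensor_apply, Representation.Equiv.symm_apply_apply, hg]
    intro φ ψ h
    refine DFunLike.ext _ _ fun v => ?_
    rw [key φ, key ψ, h]
  · intro F
    refine ⟨(g'.tensor g'').comp ((joinEquiv N k₁ k₂).symm.toIntertwiningMap.comp
      (F.1 (f' ⊗ₜ f''))), ?_⟩
    refine Subtype.ext <| TensorProduct.ext' fun x y => DFunLike.ext _ _ fun v => ?_
    -- Here `x.comp g'` is an equivariant endomorphism, so `branchHom_comp` reduces `F` at `x ⊗ y`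
    -- to its value at `f' ⊗ f''`.
    have hx : x = (x.comp g').comp f' := DFunLike.ext _ _ fun v => by
      change x v = x (g' (f' v))
      rw [h']
    have hy : y = (y.comp g'').comp f'' := DFunLike.ext _ _ fun v => by
      change y v = y (g'' (f'' v))
      rw [h'']
    conv_rhs => rw [hx, hy]
    rw [branchHom_comp, branchOfIntertwiner_apply, embedTensor_apply]
    congr 1
    change (TensorProduct.map x.toLinearMap y.toLinearMap ∘ₗ
      TensorProduct.map g'.toLinearMap g''.toLinearMap) _ = _
    rw [← TensorProduct.map_comp]
    rfl

end BranchingMultiplicity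

/-! ### Vanishing of the equivariant coupling of three isotypic tensors -/

section Coupling

variable {N k₁ k₂ : ℕ} {lam lam' lam'' : N.Partition}

/-- `finrank` is also `0` on infinite-dimensional spaces; the embedding `L` by matrix coefficients
into a finite-dimensional space excludes that case. -/
theorem intertwiningMap_eq_zero_of_finrank_eq_zero {G V W ι κ : Type*} [Monoid G]
    [AddCommMonoid V] [AddCommMonoid W] [Module ℂ V] [Module ℂ W] [Finite ι] [Finite κ]
    {ρ : Representation ℂ G V} {σ : Representation ℂ G W}
    (b : Module.Basis ι ℂ V) (c : Module.Basis κ ℂ W)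
    (h : Module.finrank ℂ (Representation.IntertwiningMap ρ σ) = 0)
    (φ : Representation.IntertwiningMap ρ σ) : φ = 0 := by
  let L : Representation.IntertwiningMap ρ σ →ₗ[ℂ] ι → κ → ℂ :=
    { toFun := fun φ i j => c.repr (φ (b i)) j
      map_add' := fun φ ψ => by ext i j; simp
      map_smul' := fun a φ => by ext i j; simp }
  have hL : Function.Injective L := fun φ ψ hφ =>
    Representation.IntertwiningMap.ext <| b.ext fun i => c.repr.injective <| Finsupp.ext fun j =>
      congrFun (congrFun hφ i) j
  have h0 : Module.finrank ℂ (LinearMap.range L) = 0 := by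
    rw [← (LinearEquiv.ofInjective L hL).finrank_eq, h]
  rw [Submodule.finrank_eq_zero] at h0
  have h1 : L φ ∈ LinearMap.range L := ⟨φ, rfl⟩
  rw [h0, Submodule.mem_bot, ← map_zero L] at h1
  exact hL h1

/-- The sum is the `(a', a'')` coordinate of `φ v`, where `φ : V_λ → V_λ' ⊗ V_λ''` embeds by `f`,
splits the tensor slots and projects to the two orthonormal copies. -/
theorem sum_mul_mul_eq_zero {ι : Type*} [Finite ι] (h : kronecker lam lam' lam'' = 0)
    (C' : ClebschGordan k₁ lam') (C'' : ClebschGordan k₂ lam'') (f : Mult (k₁ + k₂) lam)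
    (e : Module.Basis ι ℂ (Specht lam)) (v : Specht lam) (α' a' α'' a'') :
    ∑ J : Fin (k₁ + k₂) → Fin N,
      C'.mult α' (C'.irr a') (fun l => J (Fin.castAdd k₂ l)) *
        C''.mult α'' (C''.irr a'') (fun l => J (Fin.natAdd k₁ l)) * f v J = 0 := by
  let φ := ((coproj (C'.dotProduct_self α')).tensor (coproj (C''.dotProduct_self α''))).comp
    ((joinEquiv N k₁ k₂).symm.toIntertwiningMap.comp f)
  have hφ : (C'.irr.tensorProduct C''.irr).repr (φ v) (a', a'') = 0 := by
    rw [intertwiningMap_eq_zero_of_finrank_eq_zero e (C'.irr.tensorProduct C''.irr) h φ]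
    change (C'.irr.tensorProduct C''.irr).repr 0 (a', a'') = 0
    rw [map_zero]
    rfl
  rw [← hφ]
  change _ = (C'.irr.tensorProduct C''.irr).repr
    ((coproj (C'.dotProduct_self α')).tensor (coproj (C''.dotProduct_self α''))
      ((joinEquiv N k₁ k₂).symm (f v))) (a', a'')
  rw [joinEquiv_symm_apply]
  simp only [map_sum, map_smul, Representation.IntertwiningMap.tensor_apply, coproj_apply,
    dotProduct_single_one, Finsupp.coe_finsetSum, Finset.sum_apply, Finsupp.smul_apply,
    Module.Basis.tensorProduct_repr_tmul_apply, Module.Basis.repr_self, Finsupp.single_apply,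
    smul_eq_mul, mul_ite, mul_one, mul_zero, Finset.sum_ite_eq', Finset.mem_univ, if_true]
  exact Finset.sum_congr rfl fun J _ => by ring

end Coupling

/-! ### Correlators of trace operators -/

section Correlators

variable {N k : ℕ}

theorem fockInner_sum_right {ι : Type*} (s : Finset ι) (p : Fock N) (f : ι → Fock N) :
    fockInner p (∑ x ∈ s, f x) = ∑ x ∈ s, fockInner p (f x) := by
  classical
  induction s using Finset.induction_on with
  | empty => simp [fockInner]
  | insert a s ha ih => rw [Finset.sum_insert ha, Finset.sum_insert ha, fockInner_add_right, ih]

theorem fockInner_sum_left {ι : Type*} (s : Finset ι) (f : ι → Fock N) (q : Fock N) :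
    fockInner (∑ x ∈ s, f x) q = ∑ x ∈ s, fockInner (f x) q := by
  rw [← fockInner_star, fockInner_sum_right, star_sum]
  exact Finset.sum_congr rfl fun x _ => fockInner_star _ _

theorem fockInner_smul_left (c : ℂ) (p q : Fock N) :
    fockInner (c • p) q = star c * fockInner p q := by
  rw [← fockInner_star, fockInner_smul_right, star_mul', fockInner_star]

theorem fockInner_monomial (m m' : Fin N × Fin N →₀ ℕ) :
    fockInner (MvPolynomial.monomial m (1 : ℂ)) (MvPolynomial.monomial m' (1 : ℂ)) =
      if m = m' then ∏ x, ((m x).factorial : ℂ) else 0 := by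
  classical
  rw [fockInner, MvPolynomial.support_monomial, if_neg one_ne_zero, Finset.sum_singleton,
    MvPolynomial.coeff_monomial, MvPolynomial.coeff_monomial, if_pos rfl]
  simp [eq_comm]

/-- Bijections between corresponding fibres glue to a permutation. This matches equality of
monomials with existence of a complete contraction. -/
theorem exists_perm_comp_iff {α β : Type*} [Fintype α] [DecidableEq β] (p q : α → β) :
    (∃ t : Equiv.Perm α, q = p ∘ t) ↔
      ∀ x, Fintype.card {l // p l = x} = Fintype.card {l // q l = x} := by
  constructor
  · rintro ⟨t, rfl⟩ x
    exact Fintype.card_congr (t.symm.subtypeEquiv fun l => by simp)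
  · intro h
    let e := fun x => Fintype.equivOfCardEq (h x)
    refine ⟨(Equiv.sigmaFiberEquiv q).symm.trans
      ((Equiv.sigmaCongrRight fun x => (e x).symm).trans (Equiv.sigmaFiberEquiv p)), ?_⟩
    funext l
    exact ((e (q l)).symm ⟨l, rfl⟩).2.symm

open Classical in
/-- Wick's theorem: the inner product of two products of creation operators counts the
complete contractions. -/
theorem fockInner_prod_X (p q : Fin k → Fin N × Fin N) :
    fockInner (∏ l, MvPolynomial.X (p l)) (∏ l, MvPolynomial.X (q l)) =
      ∑ t : Equiv.Perm (Fin k), if q = p ∘ t then 1 else 0 := by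
  have hm : ∀ p : Fin k → Fin N × Fin N, (∏ l, MvPolynomial.X (p l) : Fock N) =
      MvPolynomial.monomial (∑ l, Finsupp.single (p l) 1) 1 := fun p => by
    rw [MvPolynomial.monomial_sum_one]
    rfl
  have hc : ∀ (p : Fin k → Fin N × Fin N) (x),
      (∑ l, Finsupp.single (p l) 1 : Fin N × Fin N →₀ ℕ) x = Fintype.card {l // p l = x} := by
    intro p x
    rw [Finsupp.finsetSum_apply, Fintype.card_subtype, Finset.card_filter]
    exact Finset.sum_congr rfl fun l _ => Finsupp.single_apply
  rw [hm, hm, fockInner_monomial]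
  simp only [Finsupp.ext_iff, hc]
  rw [if_congr (exists_perm_comp_iff p q).symm rfl rfl]
  split_ifs with h
  · obtain ⟨t₀, rfl⟩ := h
    -- The product of factorials is the order of the stabilizer of `p`, and the contractions form
    -- its coset through `t₀`.
    rw [← Nat.cast_prod, ← DomMulAct.stabilizer_card p, Fintype.card_subtype, Finset.card_filter,
      Nat.cast_sum]
    refine Fintype.sum_equiv (Equiv.mulRight t₀) _ _ fun t => ?_
    rw [Nat.cast_ite, Nat.cast_one, Nat.cast_zero]
    refine if_congr ?_ rfl rfl
    rw [Equiv.coe_mulRight, Equiv.Perm.coe_mul, ← Function.comp_assoc, eq_comm]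
    exact (t₀.surjective.injective_comp_right.eq_iff).symm
  · push Not at h
    exact (Finset.sum_eq_zero fun t _ => if_neg (h t)).symm

theorem traceCreate_apply (T : Matrix (Fin k → Fin N) (Fin k → Fin N) ℂ) (q : Fock N) :
    traceCreate T q = ∑ J, ∑ I, T J I • ((∏ l, MvPolynomial.X (J l, I l)) * q) := by
  have h : ∀ J I : Fin k → Fin N, (List.ofFn fun l => create (J l) (I l)).prod =
      Algebra.lmul ℂ (Fock N) (∏ l, MvPolynomial.X (J l, I l)) := by
    intro J I
    rw [← List.prod_ofFn, map_list_prod, List.map_ofFn]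
    rfl
  simp only [traceCreate, LinearMap.sum_apply, LinearMap.smul_apply, h]
  rfl

/-- The correlator of two trace operators as a sum over contractions. -/
theorem fockInner_traceCreate_one (A B : Matrix (Fin k → Fin N) (Fin k → Fin N) ℂ) :
    fockInner (traceCreate A 1) (traceCreate B 1) =
      ∑ t : Equiv.Perm (Fin k), ∑ J, ∑ I, star (A J I) * B (J ∘ t) (I ∘ t) := by
  classical
  have h : ∀ J I J' I' : Fin k → Fin N,
      fockInner (∏ l, MvPolynomial.X (J l, I l)) (∏ l, MvPolynomial.X (J' l, I' l)) =
      ∑ t : Equiv.Perm (Fin k), if J' = J ∘ t then if I' = I ∘ t then 1 else 0 else 0 := by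
    intro J I J' I'
    rw [fockInner_prod_X]
    refine Finset.sum_congr rfl fun t _ => ?_
    rw [← ite_and]
    refine if_congr ?_ rfl rfl
    simp only [funext_iff, Function.comp_apply, Prod.mk.injEq, forall_and]
  simp only [traceCreate_apply A, mul_one, fockInner_sum_left, fockInner_smul_left]
  simp only [traceCreate_apply B, mul_one, fockInner_sum_right, fockInner_smul_right, h]
  refine Eq.trans ?_ Finset.sum_comm
  refine Finset.sum_congr rfl fun J _ => ?_
  refine Eq.trans ?_ Finset.sum_comm
  refine Finset.sum_congr rfl fun I _ => ?_
  simp only [Finset.mul_sum]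
  conv_lhs => enter [2, J']; rw [Finset.sum_comm]
  rw [Finset.sum_comm]
  refine Finset.sum_congr rfl fun t _ => ?_
  simp

/-- A product of two trace operators is the trace operator of the tensor product. -/
theorem traceCreate_traceCreate {k₁ k₂ : ℕ} (A : Matrix (Fin k₁ → Fin N) (Fin k₁ → Fin N) ℂ)
    (B : Matrix (Fin k₂ → Fin N) (Fin k₂ → Fin N) ℂ) :
    traceCreate B (traceCreate A 1) = traceCreate (Matrix.of fun J I : Fin (k₁ + k₂) → Fin N =>
      A (fun l => J (Fin.castAdd k₂ l)) (fun l => I (Fin.castAdd k₂ l)) *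
      B (fun l => J (Fin.natAdd k₁ l)) (fun l => I (Fin.natAdd k₁ l))) 1 := by
  have hs : ∀ g : (Fin (k₁ + k₂) → Fin N) → Fock N,
      ∑ J, g J = ∑ J₂, ∑ J₁, g (Fin.append J₁ J₂) := by
    intro g
    rw [Finset.sum_comm, ← Fintype.sum_prod_type']
    exact (Fintype.sum_equiv (Fin.appendEquiv k₁ k₂) _ _ fun _ => rfl).symm
  simp only [traceCreate_apply, hs, mul_one, Finset.mul_sum, Finset.smul_sum]
  refine Finset.sum_congr rfl fun J₂ _ => ?_
  rw [Finset.sum_comm]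
  refine Finset.sum_congr rfl fun J₁ _ => Finset.sum_congr rfl fun I₂ _ =>
    Finset.sum_congr rfl fun I₁ _ => ?_
  simp only [Matrix.of_apply, Fin.prod_univ_add, Fin.append_left, Fin.append_right]
  rw [mul_smul_comm, smul_smul, mul_comm (B J₂ I₂)]
  congr 1
  exact mul_comm _ _

/-- Only the separated form matters later: row and column indices enter through vectors of copies of
`V_λ`, and the branching coefficients are absorbed into `c`. -/
theorem realize_symMatrixUnit (hN : 2 * k ≤ N) {lam : N.Partition} {gam : k.Partition}
    (R : RepBasis lam gam) (μ ν) : ∃ c : Fin _ × Fin _ × Fin _ → ℂ, ∀ J I,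
      realize N (symMatrixUnit R μ ν) J I =
        ∑ x, c x * (R.mult x.1 (R.irr x.2.2) J * R.mult x.2.1 (R.irr x.2.2) I) := by
  refine ⟨fun x => ∑ p, branchCoeff R x.1 p μ * branchCoeff R x.2.1 p ν, fun J I => ?_⟩
  simp only [Fintype.sum_prod_type]
  let L : PartAlg k →ₗ[ℂ] ℂ :=
    { toFun := fun d => realize N d J I
      map_add' := fun d d' => by
        simp [realize, Matrix.sum_apply, add_mul, Finset.sum_add_distrib]
      map_smul' := fun c d => by
        simp [realize, Matrix.sum_apply, Finset.mul_sum, mul_assoc] }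
  change L _ = _
  simp only [symMatrixUnit, map_sum, map_smul, ← Finset.sum_smul, ← Finset.mul_sum]
  refine Finset.sum_congr rfl fun α _ => Finset.sum_congr rfl fun β _ => ?_
  rw [smul_eq_mul]
  congr 1
  exact realize_matrixUnit hN R.toClebschGordan α β J I

end Correlators

/-! ### Extremal three-point correlators -/

section Extremal

variable {N k₁ k₂ : ℕ}

/-- After expansion every term factors into a row part and a column part, and the row sum alone
already vanishes. -/
theorem sum_star_mul_eq_zero {X Y Z J I J₁ I₁ J₂ I₂ : Type*} [Fintype X] [Fintype Y] [Fintype Z]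
    [Fintype J] [Fintype I] {A : J₁ → I₁ → ℂ} {B : J₂ → I₂ → ℂ} {D : J → I → ℂ}
    (p₁ : J → J₁) (p₂ : J → J₂) (q₁ : I → I₁) (q₂ : I → I₂)
    {a : X → ℂ} {b : Y → ℂ} {d : Z → ℂ} {u₁ : X → J₁ → ℂ} {w₁ : X → I₁ → ℂ}
    {u₂ : Y → J₂ → ℂ} {w₂ : Y → I₂ → ℂ} {u : Z → J → ℂ} {w : Z → I → ℂ}
    (hA : ∀ j i, A j i = ∑ x, a x * (u₁ x j * w₁ x i))
    (hB : ∀ j i, B j i = ∑ y, b y * (u₂ y j * w₂ y i))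
    (hD : ∀ j i, D j i = ∑ z, d z * (u z j * w z i))
    (h : ∀ x y z, ∑ j, star (u₁ x (p₁ j)) * star (u₂ y (p₂ j)) * u z j = 0) :
    ∑ j, ∑ i, star (A (p₁ j) (q₁ i) * B (p₂ j) (q₂ i)) * D j i = 0 := by
  have e : ∀ j i, star (A (p₁ j) (q₁ i) * B (p₂ j) (q₂ i)) * D j i = ∑ x, ∑ y, ∑ z,
      (star (u₁ x (p₁ j)) * star (u₂ y (p₂ j)) * u z j) *
        (star (a x * b y * (w₁ x (q₁ i) * w₂ y (q₂ i))) * d z * w z i) := by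
    intro j i
    rw [hA, hB, hD, star_mul', star_sum, star_sum, Finset.sum_mul_sum, Finset.sum_mul]
    refine Finset.sum_congr rfl fun x _ => ?_
    rw [Finset.sum_mul_sum]
    refine Finset.sum_congr rfl fun y _ => Finset.sum_congr rfl fun z _ => ?_
    simp only [star_mul']
    ring
  simp only [e]
  rw [Finset.sum_comm]
  refine Finset.sum_eq_zero fun i _ => ?_
  rw [Finset.sum_comm]
  refine Finset.sum_eq_zero fun x _ => ?_
  rw [Finset.sum_comm]
  refine Finset.sum_eq_zero fun y _ => ?_
  rw [Finset.sum_comm]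
  refine Finset.sum_eq_zero fun z _ => ?_
  rw [← Finset.sum_mul, h, zero_mul]

/-- The Wick permutation `t` acts on `f` as a permutation diagram, so the permuted map still lies in
`Z_λ`. -/
theorem sum_star_mul_star_mul_eq_zero {ι : Type*} [Finite ι] {lam lam' lam'' : N.Partition}
    (e : Module.Basis ι ℂ (Specht lam)) (h : kronecker lam lam' lam'' = 0)
    (C' : ClebschGordan k₁ lam') (C'' : ClebschGordan k₂ lam'') (t : Equiv.Perm (Fin (k₁ + k₂)))
    (f : Mult (k₁ + k₂) lam) (v : Specht lam) (α' a' α'' a'') :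
    ∑ J : Fin (k₁ + k₂) → Fin N,
      star (C'.mult α' (C'.irr a') (fun l => J (Fin.castAdd k₂ l))) *
        star (C''.mult α'' (C''.irr a'') (fun l => J (Fin.natAdd k₁ l))) * f v (J ∘ t) = 0 := by
  rw [← sum_mul_mul_eq_zero h C' C'' (diagAct lam (Diagram.ofPerm t) f) e v α' a' α'' a'']
  refine Finset.sum_congr rfl fun J _ => ?_
  rw [C'.real, C''.real, diagAct_ofPerm_apply]

/-- The extremal three-point correlator vanishes when the Kronecker coefficient does. -/
theorem vev_eq_zero (hN : 2 * k₁ + 2 * k₂ ≤ N) {lam lam' lam'' : N.Partition}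
    {gam : (k₁ + k₂).Partition} {gam' : k₁.Partition} {gam'' : k₂.Partition}
    (R : RepBasis lam gam) (R' : RepBasis lam' gam') (R'' : RepBasis lam'' gam'')
    (μ ν μ' ν' μ'' ν'') (h : kronecker lam lam' lam'' = 0) :
    vev (repOperatorAdj R' μ' ν' * repOperatorAdj R'' μ'' ν'' * repOperator R μ ν) = 0 := by
  obtain ⟨c, hc⟩ := realize_symMatrixUnit (by lia) R μ ν
  obtain ⟨c', hc'⟩ := realize_symMatrixUnit (by lia) R' μ' ν'
  obtain ⟨c'', hc''⟩ := realize_symMatrixUnit (by lia) R'' μ'' ν''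
  rw [repOperatorAdj, repOperatorAdj, repOperator]
  generalize realize N (symMatrixUnit R μ ν) = T at hc ⊢
  generalize realize N (symMatrixUnit R' μ' ν') = T' at hc' ⊢
  generalize realize N (symMatrixUnit R'' μ'' ν'') = T'' at hc'' ⊢
  -- Moving the adjoints to the left gives the inner product of `O'' O' |0⟩` with `O |0⟩`, to which
  -- the Wick expansion applies.
  rw [vev, Module.End.mul_apply, Module.End.mul_apply, ← fockInner_traceCreate,
    ← fockInner_traceCreate, traceCreate_traceCreate, fockInner_traceCreate_one]
  refine Finset.sum_eq_zero fun t _ => ?_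
  exact sum_star_mul_eq_zero (A := T') (B := T'') (D := fun J I => T (J ∘ t) (I ∘ t))
    (fun J l => J (Fin.castAdd k₂ l)) (fun J l => J (Fin.natAdd k₁ l))
    (fun I l => I (Fin.castAdd k₂ l)) (fun I l => I (Fin.natAdd k₁ l)) hc' hc''
    (fun J I => hc (J ∘ t) (I ∘ t)) fun x' x'' x =>
      sum_star_mul_star_mul_eq_zero R.irr h R'.toClebschGordan R''.toClebschGordan t _ _ _ _ _ _

/-- If `M_{λ → γ}` has a basis vector, so has `Z_λ`. -/
theorem RepBasis.nonempty_mult {k : ℕ} {lam : N.Partition} {gam : k.Partition}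
    (R : RepBasis lam gam) (μ : Fin (Module.finrank ℂ (BranchMult lam gam))) :
    Nonempty (Fin (Module.finrank ℂ (Mult k lam))) := by
  by_contra hempty
  rw [not_nonempty_iff] at hempty
  have : Subsingleton (Mult k lam) := R.mult.repr.toEquiv.subsingleton
  have : Subsingleton (BranchMult lam gam) := ⟨fun f g => DFunLike.ext _ _ fun v =>
    Subsingleton.elim _ _⟩
  rw [Module.finrank_zero_of_subsingleton] at μ
  exact μ.elim0

end Extremal

end PermOsc

end

theorem mainTheorem9 (N k₁ k₂ : ℕ) (hN : 2 * k₁ + 2 * k₂ ≤ N)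
    (lam lam' lam'' : N.Partition)
    (gam : (k₁ + k₂).Partition) (gam' : k₁.Partition) (gam'' : k₂.Partition)
    (R : PermOsc.RepBasis lam gam) (R' : PermOsc.RepBasis lam' gam')
    (R'' : PermOsc.RepBasis lam'' gam'')
    (μ ν : Fin (Module.finrank ℂ (PermOsc.BranchMult lam gam)))
    (μ' ν' : Fin (Module.finrank ℂ (PermOsc.BranchMult lam' gam')))
    (μ'' ν'' : Fin (Module.finrank ℂ (PermOsc.BranchMult lam'' gam''))) :
    PermOsc.branchingMultiplicity k₁ k₂ lam lam' lam'' = PermOsc.kronecker lam lam' lam'' ∧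
    (PermOsc.kronecker lam lam' lam'' = 0 →
      PermOsc.vev (PermOsc.repOperatorAdj R' μ' ν' * PermOsc.repOperatorAdj R'' μ'' ν'' *
        PermOsc.repOperator R μ ν) = 0) := by
  refine ⟨?_, PermOsc.vev_eq_zero hN R R' R'' μ ν μ' ν' μ'' ν''⟩
  -- The indices `μ'` and `μ''` force `Z_λ'` and `Z_λ''` to be non-zero; their basis vectors supply
  -- the embeddings with retractions.
  obtain ⟨α'⟩ := R'.nonempty_mult μ'
  obtain ⟨α''⟩ := R''.nonempty_mult μ''
  exact (LinearEquiv.ofBijective (PermOsc.branchOfIntertwiner k₁ k₂ lam lam' lam'')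
    (PermOsc.branchOfIntertwiner_bijective _ _ _ _
      (PermOsc.coproj_apply_self (R'.dotProduct_self α'))
      (PermOsc.coproj_apply_self (R''.dotProduct_self α'')))).finrank_eq.symm
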